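/- Let $\mathbb F$ be a finite field with $q$ elements, $\mathbb E$ its quadratic extension, $\sigma(\lambda)=\overline\lambda=\lambda^q$ the nontrivial element of $\mathrm{Gal}(\mathbb E/\mathbb F)$, $N(\lambda)=\lambda\overline\lambda$, and $G=PGL(2,\mathbb F)=GL(2,\mathbb F)/Z(GL(2,\mathbb F))$. Let $\widehat G$ be the (finite) set of isomorphism classes of complex irreducible representations of $G$, $\chi_\pi$ the character of $\pi$, and $\nu_2(\pi)=\frac1{|G|}\sum_{g\in G}\chi_\pi(g^2)$. For $s\in\mathbb C$, $e\in\{1,0,-1\}$ and $\gamma_1,\dots,\gamma_r\in G$ put $$\zeta_G(s)=\sum_{\pi\in\widehat G}\frac1{(\dim\pi)^s},\qquad \zeta_{G,e}(s)=\sum_{\pi\in\widehat G,\ \nu_2(\pi)=e}\frac1{(\dim\pi)^s},\qquad \zeta^{(r)}(\gamma_1,\dots,\gamma_r)(s)=\sum_{\pi\in\widehat G}\frac{\prod_{j=1}^r\chi_\pi(\gamma_j)}{(\dim\pi)^{s+r}}.$$ Let $u$, $d(x)$ (for $x\in\mathbb F^\times$) and $c(\lambda)$ (for $\lambda\in\mathbb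 E^\times$) be the classes in $G$ of $$\begin{pmatrix}1&1\\0&1\end{pmatrix},\qquad \begin{pmatrix}x&0\\0&1\end{pmatrix},\qquad \begin{pmatrix}0&-\lambda\overline\lambda\\1&\lambda+\overline\lambda\end{pmatrix}.$$ Let $\delta(x)=1$ if $x=1$ and $\delta(x)=0$ otherwise, let $\phi_{\mathbb F}:\mathbb E\to\{0,1\}$ be the characteristic function of $\mathbb F$, and for $q$ odd let $\epsilon$, $\epsilon_{\mathbb E}$ be the characters of $\mathbb F^\times$, $\mathbb E^\times$ with value $1$ on squares and $-1$ on non-squares. Below $s\in\mathbb C$, $r,m,n\ge1$, $x,x_i\in\mathbb F^\times\setminus\{1\}$ and $\lambda,\lambda_i\in\mathbb E\setminus\mathbb F$ are arbitrary. For every $q$, $\zeta_{G,-1}=\zeta_{G,0}=0$. If $q$ is odd: $$\zeta_G(s)=2+\frac{q-3}{2(q+1)^s}+\frac2{q^s}+\frac{q-1}{2(q-1)^s},\qquad \zeta^{(1)}(u)(s)=2+\frac{q-3}{2(q+1)^{s+1}}-\frac{q-1}{2(q-1)^{s+1}},$$ $$\zeta^{(1)}(d(x))(s)=\Bigl(1+\frac1{q^{s+1}}-\frac1{(q+1)^{s+1}}\Bigr)(1+\epsilon(x)),$$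 $$\zeta^{(1)}(c(\lambda))(s)=\Bigl(1+\frac1{(q-1)^{s+1}}-\frac1{q^{s+1}}\Bigr)+\epsilon(\lambda\overline\lambda)\Bigl(1-\frac1{q^{s+1}}\Bigr)+\frac{\epsilon_{\mathbb E}(\lambda)}{(q-1)^{s+1}},$$ $$\zeta^{(r)}(d(x_1),\dots,d(x_r))(s)=(1+\epsilon(x_1\cdots x_r))\Bigl(1+\frac1{q^{s+r}}\Bigr)+\frac1{2(q+1)^{s+r}}\sum_{\eta\in\{\pm1\}^r}\bigl((q-1)\delta(x_1^{\eta_1}\cdots x_r^{\eta_r})-1-\epsilon(x_1^{\eta_1}\cdots x_r^{\eta_r})\bigr),$$ $$\zeta^{(r)}(c(\lambda_1),\dots,c(\lambda_r))(s)=(1+\epsilon(N(\lambda_1\cdots\lambda_r)))\Bigl(1+\frac{(-1)^r}{q^{s+r}}\Bigr)+\frac{(-1)^r}{2(q-1)^{s+r}}\sum_{\eta\in\{\mathrm{id},\sigma\}^r}\bigl((q+1)\phi_{\mathbb F}(\eta_1(\lambda_1)\cdots\eta_r(\lambda_r))-1-\epsilon_{\mathbb E}(\eta_1(\lambda_1)\cdots\eta_r(\lambda_r))\bigr),$$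 $$\zeta^{(m+n)}(d(x_1),\dots,d(x_m),c(\lambda_1),\dots,c(\lambda_n))(s)=\Bigl(1+\frac{(-1)^n}{q^{s+m+n}}\Bigr)\bigl(1+\epsilon(x_1\cdots x_m\,N(\lambda_1\cdots\lambda_n))\bigr).$$ If $q$ is even: $$\zeta_G(s)=1+\frac{q-2}{2(q+1)^s}+\frac1{q^s}+\frac{q}{2(q-1)^s},\qquad \zeta^{(1)}(u)(s)=1+\frac{q-2}{2(q+1)^{s+1}}-\frac{q}{2(q-1)^{s+1}},$$ $$\zeta^{(1)}(d(x))(s)=1-\frac1{(q+1)^{s+1}}+\frac1{q^{s+1}},\qquad \zeta^{(1)}(c(\lambda))(s)=1-\frac1{q^{s+1}}+\frac1{(q-1)^{s+1}},$$ $$\zeta^{(r)}(d(x_1),\dots,d(x_r))(s)=1+\frac1{q^{s+r}}+\frac1{2(q+1)^{s+r}}\sum_{\eta\in\{\pm1\}^r}\bigl((q-1)\delta(x_1^{\eta_1}\cdots x_r^{\eta_r})-1\bigr),$$ $$\zeta^{(r)}(c(\lambda_1),\dots,c(\lambda_r))(s)=1+\frac{(-1)^r}{q^{s+r}}+\frac{(-1)^r}{2(q-1)^{s+r}}\sum_{\eta\in\{\mathrm{id},\sigma\}^r}\bigl((q+1)\phi_{\mathbb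 F}(\eta_1(\lambda_1)\cdots\eta_r(\lambda_r))-1\bigr),$$ $$\zeta^{(m+n)}(d(x_1),\dots,d(x_m),c(\lambda_1),\dots,c(\lambda_n))(s)=1+\frac{(-1)^n}{q^{s+m+n}}.$$ -/

import Mathlib

open scoped MatrixGroups

noncomputable section

/-- A complex irreducible representation of `G`, realised on the space `ℂ^dim`.  For a finite group,
every complex irreducible representation is isomorphic to one of these. -/
structure IrrRep (G : Type*) [Group G] where
  /-- the dimension -/
  dim : ℕ
  /-- the action of `G` -/
  rho : Representation ℂ G (Fin dim → ℂ)
  /-- irreducibility -/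
  irr : rho.IsIrreducible

/-- Isomorphism of representations. -/
def IrrRep.isoSetoid (G : Type*) [Group G] : Setoid (IrrRep G) where
  r π π' := Nonempty (π.rho.Equiv π'.rho)
  iseqv := ⟨fun _ => ⟨Representation.Equiv.refl _⟩, fun ⟨e⟩ => ⟨e.symm⟩,
    fun ⟨e⟩ ⟨f⟩ => ⟨e.trans f⟩⟩

/-- The set `Ĝ` of isomorphism classes of complex irreducible representations of `G`. -/
def IrrClass (G : Type*) [Group G] : Type _ := Quotient (IrrRep.isoSetoid G)

namespace IrrClass

variable {G : Type*} [Group G]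

/-- The dimension of a class of irreducible representations. -/
def dim (π : IrrClass G) : ℕ :=
  Quotient.lift (s := IrrRep.isoSetoid G) IrrRep.dim
    (fun _ _ ⟨e⟩ => by simpa using e.toLinearEquiv.finrank_eq) π

/-- The character of a class of irreducible representations. -/
def character (π : IrrClass G) : G → ℂ :=
  Quotient.lift (s := IrrRep.isoSetoid G) (fun ρ => ρ.rho.character)
    (fun _ _ ⟨e⟩ => Representation.char_iso e) π

/-- The Frobenius-Schur indicator `ν₂(π) = |G|⁻¹ ∑_g χ_π(g²)` (for `G` finite). -/
def frobeniusSchur (π : IrrClass G) : ℂ :=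
  (Nat.card G : ℂ)⁻¹ * ∑ᶠ g : G, π.character (g ^ 2)

end IrrClass

/-- The representation zeta function `ζ_G(s) = ∑_π (dim π)^{-s}` of a finite group. -/
def zetaRep (G : Type*) [Group G] (s : ℂ) : ℂ :=
  ∑ᶠ π : IrrClass G, 1 / (π.dim : ℂ) ^ s

/-- `ζ_{G,e}(s)`: the sum of `(dim π)^{-s}` over the `π` with Frobenius-Schur indicator `e`. -/
def zetaIndicator (G : Type*) [Group G] (e : ℤ) (s : ℂ) : ℂ :=
  ∑ᶠ π : {π : IrrClass G // π.frobeniusSchur = (e : ℂ)}, 1 / (π.1.dim : ℂ) ^ s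

/-- The zeta function with `r` insertions
`ζ_G^{(r)}(γ₁,…,γ_r)(s) = ∑_π (∏_j χ_π(γ_j)) / (dim π)^{s+r}`. -/
def zetaInsert {G : Type*} [Group G] {r : ℕ} (γ : Fin r → G) (s : ℂ) : ℂ :=
  ∑ᶠ π : IrrClass G, (∏ j, π.character (γ j)) / (π.dim : ℂ) ^ (s + r)

/-- `PGL(2,F) = GL(2,F)/Z(GL(2,F))`. -/
abbrev PGL2 (F : Type*) [Field F] : Type _ := GL (Fin 2) F ⧸ Subgroup.center (GL (Fin 2) F)

namespace PGL2

/-- The class of the unipotent matrix `(1 1; 0 1)`. -/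
def unip (F : Type*) [Field F] : PGL2 F :=
  QuotientGroup.mk (Matrix.GeneralLinearGroup.mkOfDetNeZero !![1, 1; 0, 1] (by simp))

/-- The class of the diagonal matrix `(x 0; 0 1)`. -/
def diag {F : Type*} [Field F] (x : Fˣ) : PGL2 F :=
  QuotientGroup.mk (Matrix.GeneralLinearGroup.mkOfDetNeZero !![(x : F), 0; 0, 1] (by simp))

/-- The class of the matrix `(0 -N(l); 1 Tr(l))`, `N` and `Tr` being the norm and trace
from `E` to `F`. -/
def ell (F : Type*) {E : Type*} [Field F] [Field E] [Algebra F E] [FiniteDimensional F E]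
    (l : Eˣ) : PGL2 F :=
  QuotientGroup.mk (Matrix.GeneralLinearGroup.mkOfDetNeZero
    !![0, -Algebra.norm F (l : E); 1, Algebra.trace F E (l : E)]
    (by simp [Matrix.det_fin_two, Algebra.norm_eq_zero_iff]))

end PGL2

/-- `δ(x) = 1` if `x = 1`, and `0` otherwise. -/
def deltaOne {F : Type*} [Field F] (x : Fˣ) : ℂ := Set.indicator {1} 1 x

/-- The characteristic function of the subfield `F` of `E`. -/
def subfieldChar (F : Type*) {E : Type*} [Field F] [Field E] [Algebra F E] (z : E) : ℂ :=
  Set.indicator (Set.range (algebraMap F E)) 1 z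

/-- The quadratic character `ε` of a finite field, with complex values: for odd characteristic and
`z ≠ 0`, it is `1` if `z` is a square and `-1` otherwise. -/
def quadSign {K : Type*} [Field K] [Fintype K] [DecidableEq K] (z : K) : ℂ :=
  (quadraticChar K z : ℂ)

end

/-! The character table of `PGL2 F` is found without constructing principal series or cuspidal
representations. Everything rests on a Weyl integration formula (`IsClassFun.avg_eq`): the mean of a
class function is half its mean over the split torus `Fˣ`, plus half its mean over the nonsplit
torus `Eˣ/Fˣ`, minus a correction `(φ 1 - φ u)/q` at the identity and the unipotent class.

Attach to a class function φ its Fourier coefficients along the two tori, shifted by `k = (φ 1 - φ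
u)/q`, with opposite signs on the two tori. The shift absorbs the correction exactly, so the pairing
of class functions becomes half the standard bilinear form on coefficient vectors
(`IsClassFun.avg_mul_inv`). For a character, the Fourier coefficients and k are multiplicities,
hence the shifted coefficients are integers. Schur orthogonality then says that an irreducible
character has an integer vector with sum of squares 2, so exactly two entries are ±1 and all others
vanish.

Three constraints fix these two entries (`IrrClass.coeffs_character_cases`). Every element of `PGL2
F` is conjugate to its inverse, so the vector is invariant under inversion of characters. Pairing
with a quadratic character of the determinant shows that the entries at a quadratic α and at α∘N
have the same parity. The dimension is not negative, which settles signs. What remains are the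
principal series, the discrete series, the Steinberg twists and the linear characters. Distinct
classes have distinct vectors, and each shape occurs because a suitable additive functional of the
coefficients is nonzero on the regular character.

A sum over irreducible classes is therefore a sum over characters of the two tori
(`finsum_irrClass`). Since the two squared entries sum to 2, one weights each class by half its
squared entries and exchanges summations. The zeta values follow by expanding products of character
values and applying orthogonality on each torus. Both parities of q are treated together through
`quadSum`, the sum over characters with `-α = α`. The same integration formula applied to `φ (g ^
2)` gives indicator 1 for every class. -/

noncomputable section

/-! ### Averages over finite types and groups -/

/-- The mean value of a function on a finite type. -/
def avg {X : Type*} (f : X → ℂ) : ℂ := (Nat.card X : ℂ)⁻¹ * ∑ᶠ x, f x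

theorem avg_eq_sum {X : Type*} [Fintype X] (f : X → ℂ) :
    avg f = (Nat.card X : ℂ)⁻¹ * ∑ x, f x := by
  rw [avg, finsum_eq_sum_of_fintype]

theorem avg_add {X : Type*} [Finite X] (f g : X → ℂ) :
    avg (fun x => f x + g x) = avg f + avg g := by
  cases nonempty_fintype X
  simp only [avg_eq_sum, Finset.sum_add_distrib, mul_add]

theorem avg_const_mul {X : Type*} [Finite X] (c : ℂ) (f : X → ℂ) :
    avg (fun x => c * f x) = c * avg f := by
  cases nonempty_fintype X
  simp only [avg_eq_sum, ← Finset.mul_sum]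
  ring

theorem avg_finset_sum {X ι : Type*} [Finite X] (s : Finset ι) (f : ι → X → ℂ) :
    avg (fun x => ∑ i ∈ s, f i x) = ∑ i ∈ s, avg (f i) := by
  cases nonempty_fintype X
  simp only [avg_eq_sum, ← Finset.mul_sum]
  rw [Finset.sum_comm]

theorem avg_equiv {X Y : Type*} (e : X ≃ Y) (f : Y → ℂ) : avg (fun x => f (e x)) = avg f := by
  rw [avg, avg, Nat.card_congr e, finsum_comp_equiv e]

theorem sum_comp_surjective {H G : Type*} [Group H] [Group G] [Fintype H] [Fintype G]
    (f : H →* G) (hf : Function.Surjective f) (φ : G → ℂ) :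
    ∑ h, φ (f h) = (Nat.card f.ker : ℂ) * ∑ g, φ g := by
  classical
  rw [← Finset.sum_fiberwise Finset.univ f, Finset.mul_sum]
  refine Finset.sum_congr rfl fun g _ => ?_
  rw [Finset.sum_congr rfl (g := fun _ => φ g) (by intro x hx; simp at hx; rw [hx]),
    Finset.sum_const, nsmul_eq_mul]
  congr 2
  rw [MonoidHom.card_fiber_eq_of_mem_range f (hf g) ⟨1, map_one f⟩, Nat.card_eq_fintype_card,
    Fintype.card_subtype]
  simp [MonoidHom.mem_ker]

theorem avg_comp_surjective {H G : Type*} [Group H] [Group G] [Finite H]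
    (f : H →* G) (hf : Function.Surjective f) (φ : G → ℂ) :
    avg (fun h => φ (f h)) = avg φ := by
  have : Finite G := Finite.of_surjective f hf
  cases nonempty_fintype H
  cases nonempty_fintype G
  have h1 := sum_comp_surjective f hf φ
  have h2 := sum_comp_surjective f hf 1
  simp only [Pi.one_apply, Finset.sum_const, Finset.card_univ, nsmul_eq_mul, mul_one,
    ← Nat.card_eq_fintype_card] at h2
  have hH : (Nat.card H : ℂ) ≠ 0 := by simp
  rw [avg_eq_sum, avg_eq_sum, h1, h2]
  rw [h2] at hH
  have h3 := left_ne_zero_of_mul hH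
  rw [mul_inv, mul_mul_mul_comm, inv_mul_cancel₀ h3, one_mul]

/-- A finite average of a character against a one-dimensional character is a multiplicity. -/
theorem exists_nat_avg_character_mul {G H V : Type*} [Group G] [Group H] [Finite H]
    [AddCommGroup V] [Module ℂ V] [FiniteDimensional ℂ V] (ρ : Representation ℂ G V)
    (f : H →* G) (θ : H →* ℂ) :
    ∃ n : ℕ, avg (fun h => ρ.character (f h) * θ h) = n := by
  cases nonempty_fintype H
  -- Twist the pullback of ρ along f by θ; the average of its character is the dimension of its
  -- invariants.
  let σ : Representation ℂ H V :=
    { toFun := fun h => θ h • ρ (f h)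
      map_one' := by simp
      map_mul' := fun a b => by simp [smul_smul, mul_comm] }
  have : Invertible (Nat.card H : ℂ) := invertibleOfNonzero (by simp)
  refine ⟨Module.finrank ℂ σ.invariants, ?_⟩
  rw [avg_eq_sum, ← σ.card_inv_mul_sum_char_eq_finrank]
  congr 1
  refine Finset.sum_congr rfl fun h _ => ?_
  simp [Representation.character, σ, mul_comm]

/-! ### Fourier analysis on finite abelian groups -/

/-- The group of characters of a (finite) abelian group. -/
abbrev Dual (A : Type*) [CommGroup A] := AddChar (Additive A) ℂ

instance (A : Type*) [CommGroup A] : AddCommGroup (Dual A) :=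
  inferInstanceAs (AddCommGroup (AddChar (Additive A) ℂ))

/-- The value of a character. -/
def Dual.ev {A : Type*} [CommGroup A] (α : Dual A) : A →* ℂ where
  toFun x := α (Additive.ofMul x)
  map_one' := by simp
  map_mul' x y := by simp [AddChar.map_add_eq_mul]

section Fourier
variable {A : Type*} [CommGroup A]

theorem Dual.ext_ev {α β : Dual A} (h : ∀ x, α.ev x = β.ev x) : α = β :=
  DFunLike.ext _ _ fun x => h x.toMul

/-- The character attached to a multiplicative map. -/
def Dual.mk (f : A →* ℂ) : Dual A where
  toFun x := f x.toMul
  map_zero_eq_one' := by simp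
  map_add_eq_mul' x y := by simp

@[simp] theorem Dual.ev_mk (f : A →* ℂ) (x : A) : (Dual.mk f).ev x = f x := rfl

@[simp] theorem Dual.ev_neg (α : Dual A) (x : A) : (-α).ev x = α.ev x⁻¹ := by
  simp [Dual.ev]

@[simp] theorem Dual.ev_zero (x : A) : (0 : Dual A).ev x = 1 := by
  simp [Dual.ev]

theorem Dual.ev_mul_ev_inv (α : Dual A) (x : A) : α.ev x * α.ev x⁻¹ = 1 := by
  rw [← map_mul, mul_inv_cancel, map_one]

/-- The Fourier coefficient of a function. -/
def fcoeff (f : A → ℂ) (α : Dual A) : ℂ := avg fun x => f x * α.ev x⁻¹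

theorem fcoeff_neg (f : A → ℂ) (hf : ∀ x, f x⁻¹ = f x) (α : Dual A) :
    fcoeff f (-α) = fcoeff f α := by
  rw [fcoeff, ← avg_equiv (Equiv.inv A)]
  simp [fcoeff, hf]

variable [Finite A]

instance : Fintype (Dual A) := Fintype.ofFinite _

theorem Dual.sum_ev [DecidableEq A] (x : A) :
    ∑ α : Dual A, α.ev x = if x = 1 then (Nat.card A : ℂ) else 0 := by
  cases nonempty_fintype A
  have := AddChar.sum_apply_eq_ite (Additive.ofMul x)
  simpa [Dual.ev, Nat.card_eq_fintype_card] using this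

theorem Dual.card_eq : (Fintype.card (Dual A) : ℂ) = Nat.card A := by
  classical
  simpa using Dual.sum_ev (1 : A)

theorem Dual.avg_ev [DecidableEq (Dual A)] (α : Dual A) :
    avg (fun x => α.ev x) = if α = 0 then 1 else 0 := by
  cases nonempty_fintype A
  have := AddChar.sum_eq_ite α
  rw [avg_eq_sum, ← Fintype.sum_equiv Additive.toMul (fun x : Additive A => α x)
    (fun x => α.ev x) (fun x => rfl), this]
  split_ifs <;> simp [Nat.card_eq_fintype_card]

theorem sum_fcoeff_mul_ev (f : A → ℂ) (x : A) : ∑ α, fcoeff f α * α.ev x = f x := by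
  classical
  cases nonempty_fintype A
  simp only [fcoeff, avg_eq_sum, Finset.mul_sum, Finset.sum_mul]
  rw [Finset.sum_comm]
  have (y : A) : ∑ α : Dual A, (Nat.card A : ℂ)⁻¹ * (f y * α.ev y⁻¹) * α.ev x =
      (Nat.card A : ℂ)⁻¹ * f y * (if y⁻¹ * x = 1 then (Nat.card A : ℂ) else 0) := by
    rw [← Dual.sum_ev, Finset.mul_sum]
    refine Finset.sum_congr rfl fun α _ => ?_
    rw [map_mul]; ring
  have hA : (Nat.card A : ℂ) ≠ 0 := by simp
  simp only [this, inv_mul_eq_one]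
  rw [Finset.sum_eq_single x (by intro y _ h; simp [h]) (by simp), if_pos rfl]
  field_simp

theorem sum_fcoeff (f : A → ℂ) : ∑ α, fcoeff f α = f 1 := by
  simpa using sum_fcoeff_mul_ev f 1

/-- Parseval in bilinear form: inversion replaces complex conjugation, so no unitarity is needed. -/
theorem avg_mul_eq_sum_fcoeff (f g : A → ℂ) :
    avg (fun x => f x * g x⁻¹) = ∑ α, fcoeff f α * fcoeff g α := by
  have (x : A) : f x * g x⁻¹ = ∑ α, fcoeff g α * (f x * α.ev x⁻¹) := by
    rw [← sum_fcoeff_mul_ev g, Finset.mul_sum]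
    exact Finset.sum_congr rfl fun α _ => by ring
  simp only [this]
  rw [avg_finset_sum]
  refine Finset.sum_congr rfl fun α _ => ?_
  rw [avg_const_mul, mul_comm]
  rfl

/-- Squaring the argument turns α into 2α, and a nontrivial character has mean zero. Only the α with
2α = 0 survive. -/
theorem avg_sq_eq_sum_fcoeff (f : A → ℂ) [DecidableEq (Dual A)] :
    avg (fun x => f (x ^ 2)) = ∑ α with -α = α, fcoeff f α := by
  have (x : A) : f (x ^ 2) = ∑ α, fcoeff f α * (α + α).ev x := by
    rw [← sum_fcoeff_mul_ev f]
    refine Finset.sum_congr rfl fun α _ => ?_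
    congr 1
    simp [Dual.ev, sq, AddChar.map_add_eq_mul]
  simp only [this]
  rw [avg_finset_sum, Finset.sum_filter]
  refine Finset.sum_congr rfl fun α _ => ?_
  rw [avg_const_mul, Dual.avg_ev]
  simp [add_eq_zero_iff_neg_eq]

theorem fcoeff_ev [DecidableEq (Dual A)] (α β : Dual A) :
    fcoeff α.ev β = if β = α then 1 else 0 := by
  have : fcoeff α.ev β = avg (fun x => (α - β).ev x) := by
    simp [fcoeff, Dual.ev, AddChar.sub_apply, AddChar.map_neg_eq_inv]
  rw [this, Dual.avg_ev]
  simp [sub_eq_zero, eq_comm]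

theorem exists_nat_fcoeff_character {G V : Type*} [Group G]
    [AddCommGroup V] [Module ℂ V] [FiniteDimensional ℂ V] (ρ : Representation ℂ G V)
    (f : A →* G) (α : Dual A) : ∃ n : ℕ, fcoeff (fun x => ρ.character (f x)) α = n := by
  obtain ⟨n, hn⟩ := exists_nat_avg_character_mul ρ f (-α).ev
  exact ⟨n, by simpa [fcoeff] using hn⟩

end Fourier

end

noncomputable section

/-! ### Summing a class function over two by two matrices -/

section MatrixSum

open Matrix

variable {F E : Type*} [Field F] [Field E] [Algebra F E]

/-- The columns of P are v and Mv for a cyclic vector v, and the relation is Cayley–Hamilton. One of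
e₁, e₂, e₁ + e₂ is cyclic as soon as M is not scalar. -/
theorem matrix_fin_two_intertwines_companion {M : Matrix (Fin 2) (Fin 2) F}
    (hM : ∀ z : F, M ≠ !![z, 0; 0, z]) :
    ∃ P : Matrix (Fin 2) (Fin 2) F, P.det ≠ 0 ∧ P * !![0, -M.det; 1, M.trace] = M * P := by
  obtain ⟨a, b, c, d, rfl⟩ : ∃ a b c d, M = !![a, b; c, d] := ⟨_, _, _, _, M.eta_fin_two⟩
  by_cases hc : c = 0
  · by_cases hb : b = 0
    · refine ⟨!![1, a; 1, d], ?_, ?_⟩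
      · rw [det_fin_two_of]
        intro h
        refine hM a ?_
        rw [hb, hc, show d = a by linear_combination h]
      · ext i j; fin_cases i <;> fin_cases j <;>
          simp [Matrix.mul_apply, Fin.sum_univ_two, det_fin_two_of, trace_fin_two, hb, hc] <;> ring
    · refine ⟨!![0, b; 1, d], by simp [det_fin_two_of, hb], ?_⟩
      ext i j; fin_cases i <;> fin_cases j <;>
        simp [Matrix.mul_apply, Fin.sum_univ_two, det_fin_two_of, trace_fin_two] <;> ring
  · refine ⟨!![1, a; 0, c], by simp [det_fin_two_of, hc], ?_⟩
    ext i j; fin_cases i <;> fin_cases j <;>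
      simp [Matrix.mul_apply, Fin.sum_univ_two, det_fin_two_of, trace_fin_two] <;> ring

theorem sq_sub_trace_mul_add_norm (hE : Module.finrank F E = 2) (x : E) :
    x * x - algebraMap F E (Algebra.trace F E x) * x + algebraMap F E (Algebra.norm F x) = 0 := by
  have : FiniteDimensional F E := .of_finrank_pos (by omega)
  let b := Module.finBasisOfFinrankEq F E hE
  apply Algebra.leftMulMatrix_injective b
  rw [Algebra.trace_eq_matrix_trace b, Algebra.norm_eq_matrix_det b]
  simp only [map_add, map_sub, map_mul, map_zero, AlgHom.commutes]
  generalize Algebra.leftMulMatrix b x = M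
  ext i j; fin_cases i <;> fin_cases j <;>
    simp [Matrix.mul_apply, Fin.sum_univ_two, det_fin_two, trace_fin_two, algebraMap_matrix_apply]
      <;> ring

theorem leftMulMatrix_algebraMap_fin_two (b : Module.Basis (Fin 2) F E) (z : F) :
    Algebra.leftMulMatrix b (algebraMap F E z) = !![z, 0; 0, z] := by
  rw [AlgHom.commutes]
  ext i j; fin_cases i <;> fin_cases j <;> simp [algebraMap_matrix_apply]

theorem leftMulMatrix_ne_scalar (b : Module.Basis (Fin 2) F E) {x : E}
    (hx : x ∉ Set.range (algebraMap F E)) (z : F) :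
    Algebra.leftMulMatrix b x ≠ !![z, 0; 0, z] := by
  rw [← leftMulMatrix_algebraMap_fin_two b]
  exact fun h => hx ⟨z, (Algebra.leftMulMatrix_injective b h).symm⟩

variable (F E) in
/-- Trace and norm on the two quadratic étale algebras `E` and `F × F`. -/
def traceNorm : E ⊕ F × F → F × F :=
  Sum.elim (fun x => (Algebra.trace F E x, Algebra.norm F x)) fun p => (p.1 + p.2, p.1 * p.2)

/-- A point of the fibre over (t, n) is a root of X² - tX + n in E, or an ordered factorisation of
it over F. Distinct roots in F give two orderings and nothing from E; a double root r gives (r, r)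
and the element r of E; without roots in F only the at most two roots in E remain. The argument is
uniform in the characteristic. -/
theorem exists_traceNorm_fiber_subset (hE : Module.finrank F E = 2) (y : F × F) :
    ∃ u v : E ⊕ F × F, ∀ x, traceNorm F E x = y → x = u ∨ x = v := by
  have key (r s x : E) (h1 : x * x - (r + s) * x + r * s = 0) : x = r ∨ x = s := by
    have : (x - r) * (x - s) = 0 := by linear_combination h1
    simpa [sub_eq_zero] using this
  have keyF (r s x : F) (h1 : x * x - (r + s) * x + r * s = 0) : x = r ∨ x = s := by
    have : (x - r) * (x - s) = 0 := by linear_combination h1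
    simpa [sub_eq_zero] using this
  obtain ⟨t, n⟩ := y
  by_cases hroot : ∃ r s : F, r + s = t ∧ r * s = n
  · obtain ⟨r, s, rfl, rfl⟩ := hroot
    have hF (p : F × F) (hp : traceNorm F E (.inr p) = (r + s, r * s)) :
        p = (r, s) ∨ p = (s, r) := by
      simp only [traceNorm, Sum.elim_inr, Prod.mk.injEq] at hp
      rcases keyF r s p.1 (by rw [← hp.1, ← hp.2]; ring) with h | h
      · exact .inl (Prod.ext h (by linear_combination hp.1 - h))
      · exact .inr (Prod.ext h (by linear_combination hp.1 - h))
    have hEx (x : E) (hx : traceNorm F E (.inl x) = (r + s, r * s)) :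
        r = s ∧ x = algebraMap F E r := by
      simp only [traceNorm, Sum.elim_inl, Prod.mk.injEq] at hx
      have h := sq_sub_trace_mul_add_norm hE x
      rw [hx.1, hx.2, map_add, map_mul] at h
      have h2 : ∀ z : F, Algebra.trace F E (algebraMap F E z) = 2 * z := fun z => by
        rw [Algebra.trace_algebraMap, hE, nsmul_eq_mul]; norm_num
      rcases key _ _ _ h with rfl | rfl
      · rw [h2] at hx
        exact ⟨by linear_combination hx.1, rfl⟩
      · rw [h2] at hx
        have : r = s := by linear_combination -hx.1
        exact ⟨this, by rw [this]⟩
    by_cases hrs : r = s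
    · refine ⟨.inr (r, s), .inl (algebraMap F E r), ?_⟩
      rintro (x | p) hx
      · exact .inr (by rw [(hEx x hx).2])
      · rcases hF p hx with rfl | rfl
        · exact .inl rfl
        · exact .inl (by rw [hrs])
    · refine ⟨.inr (r, s), .inr (s, r), ?_⟩
      rintro (x | p) hx
      · exact absurd (hEx x hx).1 hrs
      · rcases hF p hx with rfl | rfl <;> simp
  · by_cases hex : ∃ x : E, traceNorm F E (.inl x) = (t, n)
    · obtain ⟨x₀, h₀⟩ := hex
      refine ⟨.inl x₀, .inl (algebraMap F E t - x₀), ?_⟩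
      rintro (x | p) hx
      · simp only [traceNorm, Sum.elim_inl, Prod.mk.injEq] at h₀ hx
        have e₀ := sq_sub_trace_mul_add_norm hE x₀
        have e := sq_sub_trace_mul_add_norm hE x
        rw [h₀.1, h₀.2] at e₀
        rw [hx.1, hx.2] at e
        rcases key x₀ (algebraMap F E t - x₀) x (by linear_combination e - e₀) with h | h <;>
          simp [h]
      · simp only [traceNorm, Sum.elim_inr, Prod.mk.injEq] at hx
        exact absurd ⟨p.1, p.2, hx.1, hx.2⟩ hroot
    · refine ⟨.inr 0, .inr 0, ?_⟩
      rintro (x | p) hx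
      · exact absurd ⟨x, hx⟩ hex
      · simp only [traceNorm, Sum.elim_inr, Prod.mk.injEq] at hx
        exact absurd ⟨p.1, p.2, hx.1, hx.2⟩ hroot

theorem apply_eq_apply_companion {φ : Matrix (Fin 2) (Fin 2) F → ℂ}
    (hφ : ∀ P M N : Matrix (Fin 2) (Fin 2) F, P.det ≠ 0 → P * M = N * P → φ M = φ N)
    {M : Matrix (Fin 2) (Fin 2) F} (hM : ∀ z : F, M ≠ !![z, 0; 0, z]) :
    φ M = φ !![0, -M.det; 1, M.trace] := by
  obtain ⟨P, hP, h⟩ := matrix_fin_two_intertwines_companion hM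
  exact (hφ P _ _ hP h).symm

variable [Fintype F] [Fintype E]

/-- The q² fibres have at most two points each and 2q² points in total, so each has exactly two. -/
theorem sum_trace_norm_add_sum (hE : Module.finrank F E = 2) (Ψ : F × F → ℂ) :
    ∑ x : E, Ψ (Algebra.trace F E x, Algebra.norm F x) + ∑ p : F × F, Ψ (p.1 + p.2, p.1 * p.2) =
      2 * ∑ y, Ψ y := by
  classical
  have hcard : Fintype.card E = Fintype.card F ^ 2 := by
    have := Module.card_eq_pow_finrank (K := F) (V := E)
    rwa [hE] at this
  have hle (y : F × F) : (Finset.univ.filter fun x => traceNorm F E x = y).card ≤ 2 := by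
    obtain ⟨u, v, h⟩ := exists_traceNorm_fiber_subset hE y
    refine (Finset.card_le_card (t := {u, v}) fun x hx => ?_).trans Finset.card_le_two
    simpa using h x (by simpa using hx)
  have htot : ∑ y : F × F, (Finset.univ.filter fun x => traceNorm F E x = y).card =
      ∑ y : F × F, 2 := by
    rw [← Finset.card_eq_sum_card_fiberwise (by simp)]
    simp [hcard]
    ring
  have hfib := (Finset.sum_eq_sum_iff_of_le fun y _ => hle y).mp htot
  have h1 : ∑ x : E, Ψ (Algebra.trace F E x, Algebra.norm F x) +
      ∑ p : F × F, Ψ (p.1 + p.2, p.1 * p.2) = ∑ x : E ⊕ F × F, Ψ (traceNorm F E x) := by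
    rw [Fintype.sum_sum_type]
    rfl
  rw [h1, ← Finset.sum_fiberwise Finset.univ (traceNorm F E), Finset.mul_sum]
  refine Finset.sum_congr rfl fun y _ => ?_
  rw [Finset.sum_congr rfl (g := fun _ => Ψ y) (by intro x hx; simp at hx; rw [hx]),
    Finset.sum_const, hfib y (Finset.mem_univ y), nsmul_eq_mul]
  norm_num

/-- For b ≠ 0 the product bc runs once through F; b = 0 contributes the value at 0, q times. -/
theorem sum_sum_mul (h : F → ℂ) :
    ∑ b : F, ∑ c : F, h (b * c) =
      ((Fintype.card F : ℂ) - 1) * ∑ m, h m + (Fintype.card F : ℂ) * h 0 := by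
  classical
  have hb (b : F) : ∑ c : F, h (b * c) =
      (∑ m, h m) + if b = 0 then (Fintype.card F : ℂ) * h 0 - ∑ m, h m else 0 := by
    split_ifs with hb
    · simp [hb]
    · rw [add_zero]
      exact Fintype.sum_equiv (Equiv.mulLeft₀ b hb) _ _ fun c => rfl
  simp only [hb, Finset.sum_add_distrib]
  simp
  ring

theorem sum_matrix_trace_det (Ψ : F × F → ℂ) :
    ∑ M : Matrix (Fin 2) (Fin 2) F, Ψ (M.trace, M.det) =
      (Fintype.card F : ℂ) * ((Fintype.card F : ℂ) - 1) * ∑ y, Ψ y +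
        (Fintype.card F : ℂ) * ∑ p : F × F, Ψ (p.1 + p.2, p.1 * p.2) := by
  let e : Matrix (Fin 2) (Fin 2) F ≃ (F × F) × (F × F) :=
    { toFun := fun M => ((M 0 0, M 1 1), (M 0 1, M 1 0))
      invFun := fun p => !![p.1.1, p.2.1; p.2.2, p.1.2]
      left_inv := fun M => M.eta_fin_two.symm
      right_inv := fun p => by simp }
  rw [Fintype.sum_equiv e _ (fun p => Ψ (p.1.1 + p.1.2, p.1.1 * p.1.2 - p.2.1 * p.2.2))
    (fun M => by simp [e, trace_fin_two, det_fin_two]), Fintype.sum_prod_type]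
  have h1 (p : F × F) : ∑ y : F × F, Ψ (p.1 + p.2, p.1 * p.2 - y.1 * y.2) =
      ((Fintype.card F : ℂ) - 1) * ∑ n, Ψ (p.1 + p.2, n) +
        (Fintype.card F : ℂ) * Ψ (p.1 + p.2, p.1 * p.2) := by
    rw [Fintype.sum_prod_type, sum_sum_mul fun m => Ψ (p.1 + p.2, p.1 * p.2 - m), sub_zero,
      ← Equiv.sum_comp (Equiv.subLeft (p.1 * p.2)) fun n => Ψ (p.1 + p.2, n)]
    rfl
  simp only [h1, Finset.sum_add_distrib, ← Finset.mul_sum]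
  have h2 : ∑ p : F × F, ∑ n, Ψ (p.1 + p.2, n) = (Fintype.card F : ℂ) * ∑ y, Ψ y := by
    rw [Fintype.sum_prod_type]
    have (a : F) : ∑ d : F, ∑ n, Ψ (a + d, n) = ∑ y, Ψ y := by
      rw [Fintype.sum_prod_type]
      exact Fintype.sum_equiv (Equiv.addLeft a) _ _ fun d => rfl
    simp [this]
  rw [h2]
  ring

/-- Replacing each matrix by its companion matrix changes φ only at scalars, where the companion of
z is conjugate to the Jordan block of z. The correction is thus the same for every family that
contains each scalar exactly once. -/
theorem sum_apply_eq_sum_companion_sub {φ : Matrix (Fin 2) (Fin 2) F → ℂ}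
    (hφ : ∀ P M N : Matrix (Fin 2) (Fin 2) F, P.det ≠ 0 → P * M = N * P → φ M = φ N)
    {X : Type*} [Fintype X] (m : X → Matrix (Fin 2) (Fin 2) F) (i : F → X)
    (hi : ∀ z, m (i z) = !![z, 0; 0, z])
    (hm : ∀ x, x ∉ Set.range i → ∀ z : F, m x ≠ !![z, 0; 0, z]) :
    ∑ x, φ (m x) = ∑ x, φ !![0, -(m x).det; 1, (m x).trace] -
      ∑ z : F, (φ !![z, 1; 0, z] - φ !![z, 0; 0, z]) := by
  have hinj : Function.Injective i := fun z w h => by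
    have := (hi z).symm.trans ((congrArg m h).trans (hi w))
    simpa using congrFun (congrFun this 0) 0
  have hu (z : F) : φ !![0, -(z * z); 1, z + z] = φ !![z, 1; 0, z] := by
    rw [apply_eq_apply_companion hφ (M := !![z, 1; 0, z])]
    · simp [trace_fin_two, det_fin_two_of]
    · intro w h
      simpa using congrFun (congrFun h 0) 1
  have := Fintype.sum_of_injective i hinj (fun z => φ !![z, 1; 0, z] - φ !![z, 0; 0, z])
    (fun x => φ !![0, -(m x).det; 1, (m x).trace] - φ (m x))
    (fun x hx => by rw [apply_eq_apply_companion hφ (hm x hx), sub_self])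
    (fun z => by simp only [hi z]; rw [← hu]; simp [trace_fin_two, det_fin_two_of])
  rw [this, Finset.sum_sub_distrib]
  ring

/-- Weyl's integration formula for two by two matrices. -/
theorem sum_matrix_eq (hE : Module.finrank F E = 2) (b : Module.Basis (Fin 2) F E)
    (φ : Matrix (Fin 2) (Fin 2) F → ℂ)
    (hφ : ∀ P M N : Matrix (Fin 2) (Fin 2) F, P.det ≠ 0 → P * M = N * P → φ M = φ N) :
    ∑ M, φ M =
      (Fintype.card F : ℂ) * ((Fintype.card F : ℂ) - 1) / 2 *
          ∑ x : E, φ (Algebra.leftMulMatrix b x) +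
        (Fintype.card F : ℂ) * ((Fintype.card F : ℂ) + 1) / 2 *
          ∑ p : F × F, φ !![p.1, 0; 0, p.2] +
        ((Fintype.card F : ℂ) ^ 2 - 1) * ∑ z : F, (φ !![z, 1; 0, z] - φ !![z, 0; 0, z]) := by
  -- On companion matrices φ depends only on trace and determinant, so the claim reduces to the two
  -- counting identities `h4` and `h5`. The scalar corrections of the three families add up to the
  -- factor q(q-1)/2 + q(q+1)/2 - 1 = q² - 1.
  let Ψ : F × F → ℂ := fun y => φ !![0, -y.2; 1, y.1]
  have h1 := sum_apply_eq_sum_companion_sub hφ (fun M => M) (fun z => !![z, 0; 0, z]) (fun z => rfl)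
    (fun M hM z h => hM ⟨z, h.symm⟩)
  have h2 := sum_apply_eq_sum_companion_sub hφ (fun x => Algebra.leftMulMatrix b x) (algebraMap F E)
    (leftMulMatrix_algebraMap_fin_two b) (fun x hx => leftMulMatrix_ne_scalar b hx)
  have h3 := sum_apply_eq_sum_companion_sub hφ (fun p : F × F => !![p.1, 0; 0, p.2]) (fun z => (z, z)) (fun z => rfl)
    (fun p hp z h => hp ⟨z, Prod.ext (by simpa using (congrFun (congrFun h 0) 0).symm)
      (by simpa using (congrFun (congrFun h 1) 1).symm)⟩)
  simp only [← Algebra.trace_eq_matrix_trace, ← Algebra.norm_eq_matrix_det] at h2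
  simp only [trace_fin_two_of, det_fin_two_of, mul_zero, sub_zero] at h3
  have h4 := sum_matrix_trace_det Ψ
  have h5 := sum_trace_norm_add_sum hE Ψ
  simp only [Ψ] at h4 h5
  rw [h1, h2, h3]
  linear_combination h4 - (Fintype.card F : ℂ) * ((Fintype.card F : ℂ) - 1) / 2 * h5

end MatrixSum

end

noncomputable section

/-! ### Class functions on `PGL(2, F)` -/

section ClassFunction

open Matrix

/-- Functions invariant under conjugation. -/
def IsClassFun {G : Type*} [Group G] (φ : G → ℂ) : Prop := ∀ g h, φ (h * g * h⁻¹) = φ g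

variable {F : Type*} [Field F]

theorem PGL2.mk_eq_mk {A B : GL (Fin 2) F} (z : F)
    (h : (A : Matrix (Fin 2) (Fin 2) F) = !![z, 0; 0, z] * B) :
    (QuotientGroup.mk A : PGL2 F) = QuotientGroup.mk B := by
  rw [eq_comm, QuotientGroup.eq, Matrix.GeneralLinearGroup.mem_center_iff_val_mem_range_scalar]
  refine ⟨z, ?_⟩
  rw [Units.val_mul, h, show !![z, 0; 0, z] = scalar (Fin 2) z by
    ext i j; fin_cases i <;> fin_cases j <;> simp, ← mul_assoc, ← scalar_comm z (Commute.all z),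
    mul_assoc, Units.inv_mul, mul_one]

theorem PGL2.mk_eq_one {A : GL (Fin 2) F} (z : F)
    (h : (A : Matrix (Fin 2) (Fin 2) F) = !![z, 0; 0, z]) :
    (QuotientGroup.mk A : PGL2 F) = 1 :=
  PGL2.mk_eq_mk (B := 1) z (by rw [h, Units.val_one, mul_one])

open scoped Classical in
/-- The conjugation invariant function on matrices attached to a function on `PGL(2, F)`. -/
def extendByZero (φ : PGL2 F → ℂ) (M : Matrix (Fin 2) (Fin 2) F) : ℂ :=
  if h : M.det ≠ 0 then φ (QuotientGroup.mk (Matrix.GeneralLinearGroup.mkOfDetNeZero M h)) else 0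

theorem extendByZero_val (φ : PGL2 F → ℂ) (g : GL (Fin 2) F) :
    extendByZero φ g = φ (QuotientGroup.mk g) := by
  have h : (g : Matrix (Fin 2) (Fin 2) F).det ≠ 0 := (g.isUnit.map Matrix.detMonoidHom).ne_zero
  rw [extendByZero, dif_pos h]
  congr 2
  exact Units.ext rfl

theorem extendByZero_of_det_ne_zero (φ : PGL2 F → ℂ) {M : Matrix (Fin 2) (Fin 2) F}
    (h : M.det ≠ 0) : extendByZero φ M =
      φ (QuotientGroup.mk (Matrix.GeneralLinearGroup.mkOfDetNeZero M h)) := dif_pos h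

theorem extendByZero_of_det_eq_zero (φ : PGL2 F → ℂ) {M : Matrix (Fin 2) (Fin 2) F}
    (h : M.det = 0) : extendByZero φ M = 0 := dif_neg (by simpa using h)

theorem IsClassFun.extendByZero_eq {φ : PGL2 F → ℂ} (hφ : IsClassFun φ)
    (P M N : Matrix (Fin 2) (Fin 2) F) (hP : P.det ≠ 0) (h : P * M = N * P) :
    extendByZero φ M = extendByZero φ N := by
  have hdet : M.det = N.det := by
    have := congrArg Matrix.det h
    rw [det_mul, det_mul, mul_comm] at this
    exact mul_right_cancel₀ hP this
  by_cases hM : M.det = 0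
  · rw [extendByZero_of_det_eq_zero φ hM, extendByZero_of_det_eq_zero φ (hdet ▸ hM)]
  · rw [extendByZero_of_det_ne_zero φ hM, extendByZero_of_det_ne_zero φ (hdet ▸ hM),
      ← hφ _ (QuotientGroup.mk (Matrix.GeneralLinearGroup.mkOfDetNeZero P hP))]
    rw [← QuotientGroup.mk_mul, ← QuotientGroup.mk_inv, ← QuotientGroup.mk_mul]
    congr 2
    rw [mul_inv_eq_iff_eq_mul]
    exact Units.ext h

/-- Both matrices are conjugate to the same companion matrix. -/
theorem IsClassFun.apply_mk_eq {φ : PGL2 F → ℂ} (hφ : IsClassFun φ) {A B : GL (Fin 2) F}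
    (hA : ∀ z : F, (A : Matrix (Fin 2) (Fin 2) F) ≠ !![z, 0; 0, z])
    (hB : ∀ z : F, (B : Matrix (Fin 2) (Fin 2) F) ≠ !![z, 0; 0, z])
    (htr : (A : Matrix (Fin 2) (Fin 2) F).trace = (B : Matrix (Fin 2) (Fin 2) F).trace)
    (hdet : (A : Matrix (Fin 2) (Fin 2) F).det = (B : Matrix (Fin 2) (Fin 2) F).det) :
    φ (QuotientGroup.mk A) = φ (QuotientGroup.mk B) := by
  rw [← extendByZero_val φ A, ← extendByZero_val φ B, apply_eq_apply_companion hφ.extendByZero_eq hA,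
    apply_eq_apply_companion hφ.extendByZero_eq hB, htr, hdet]

/-- In `PGL2 F` the adjugate represents the inverse, and a 2×2 adjugate has the same trace and
determinant as the matrix. Hence every element is conjugate to its inverse. -/
theorem IsClassFun.apply_inv {φ : PGL2 F → ℂ} (hφ : IsClassFun φ) (g : PGL2 F) :
    φ g⁻¹ = φ g := by
  obtain ⟨A, rfl⟩ := QuotientGroup.mk_surjective g
  by_cases hA : ∃ z : F, (A : Matrix (Fin 2) (Fin 2) F) = !![z, 0; 0, z]
  · obtain ⟨z, hz⟩ := hA
    rw [PGL2.mk_eq_one z hz, inv_one]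
  · push Not at hA
    have hdet : (A : Matrix (Fin 2) (Fin 2) F).det ≠ 0 :=
      (A.isUnit.map Matrix.detMonoidHom).ne_zero
    have hadj : (A : Matrix (Fin 2) (Fin 2) F).adjugate.det ≠ 0 := by
      simpa [det_adjugate] using hdet
    obtain ⟨a, b, c, d, habcd⟩ : ∃ a b c d, (A : Matrix (Fin 2) (Fin 2) F) = !![a, b; c, d] :=
      ⟨_, _, _, _, Matrix.eta_fin_two _⟩
    have : (QuotientGroup.mk A : PGL2 F)⁻¹ =
        QuotientGroup.mk (Matrix.GeneralLinearGroup.mkOfDetNeZero _ hadj) := by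
      rw [inv_eq_iff_mul_eq_one, ← QuotientGroup.mk_mul]
      refine PGL2.mk_eq_one (A : Matrix (Fin 2) (Fin 2) F).det ?_
      change (A : Matrix (Fin 2) (Fin 2) F) * (A : Matrix (Fin 2) (Fin 2) F).adjugate = _
      rw [mul_adjugate]
      ext i j; fin_cases i <;> fin_cases j <;> simp
    rw [this]
    refine hφ.apply_mk_eq ?_ hA ?_ ?_
    · intro z h
      change (A : Matrix (Fin 2) (Fin 2) F).adjugate = _ at h
      apply hA z
      rw [habcd, adjugate_fin_two_of] at h
      have h00 := congrFun (congrFun h 0) 0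
      have h01 := congrFun (congrFun h 0) 1
      have h10 := congrFun (congrFun h 1) 0
      have h11 := congrFun (congrFun h 1) 1
      simp at h00 h01 h10 h11
      rw [habcd, h00, h01, h10, h11]
    · change (A : Matrix (Fin 2) (Fin 2) F).adjugate.trace = _
      rw [habcd, adjugate_fin_two_of]
      simp [trace_fin_two, add_comm]
    · change (A : Matrix (Fin 2) (Fin 2) F).adjugate.det = _
      rw [habcd, adjugate_fin_two_of]
      simp only [det_fin_two_of]
      ring

/-! ### The tori and the unipotent subgroup -/

variable (F) in
/-- The split torus. -/
def splitHom : Fˣ →* PGL2 F where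
  toFun := PGL2.diag
  map_one' := PGL2.mk_eq_one 1 (by simp [Matrix.GeneralLinearGroup.mkOfDetNeZero])
  map_mul' x y := by
    rw [PGL2.diag, PGL2.diag, PGL2.diag, ← QuotientGroup.mk_mul]
    congr 1
    ext i j; fin_cases i <;> fin_cases j <;> simp [Matrix.GeneralLinearGroup.mkOfDetNeZero]

variable (F) in
/-- The subgroup of upper unipotent matrices. -/
def unipHom : Multiplicative F →* PGL2 F where
  toFun y := QuotientGroup.mk
    (Matrix.GeneralLinearGroup.mkOfDetNeZero !![1, y.toAdd; 0, 1] (by simp))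
  map_one' := PGL2.mk_eq_one 1 (by simp [Matrix.GeneralLinearGroup.mkOfDetNeZero])
  map_mul' x y := by
    rw [← QuotientGroup.mk_mul]
    congr 1
    ext i j; fin_cases i <;> fin_cases j <;>
      simp [Matrix.GeneralLinearGroup.mkOfDetNeZero, add_comm]

theorem IsClassFun.apply_unipHom {φ : PGL2 F → ℂ} (hφ : IsClassFun φ) {y : Multiplicative F}
    (hy : y ≠ 1) : φ (unipHom F y) = φ (PGL2.unip F) := by
  refine hφ.apply_mk_eq ?_ ?_ ?_ ?_
  · intro z h
    exact hy (by simpa using congrFun (congrFun h 0) 1)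
  · intro z h
    simpa using congrFun (congrFun h 0) 1
  · simp [Matrix.GeneralLinearGroup.mkOfDetNeZero, trace_fin_two]
  · simp [Matrix.GeneralLinearGroup.mkOfDetNeZero, det_fin_two]

variable (F) (E : Type*) [Field E] [Algebra F E]

/-- The quotient `Eˣ / Fˣ`, the group of points of a nonsplit torus of `PGL(2)`. -/
abbrev NonsplitTorus : Type _ := Eˣ ⧸ (Units.map (algebraMap F E : F →* E)).range

variable {F E}

/-- The nonsplit torus. -/
def nonsplitHom (b : Module.Basis (Fin 2) F E) : NonsplitTorus F E →* PGL2 F :=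
  QuotientGroup.lift _ ((QuotientGroup.mk' _).comp
    (Units.map (Algebra.leftMulMatrix b : E →* Matrix (Fin 2) (Fin 2) F))) (by
      rintro _ ⟨z, rfl⟩
      exact PGL2.mk_eq_one (z : F) (leftMulMatrix_algebraMap_fin_two b _))

theorem nonsplitHom_mk (b : Module.Basis (Fin 2) F E) (l : Eˣ) :
    nonsplitHom b (QuotientGroup.mk l) = QuotientGroup.mk
      (Units.map (Algebra.leftMulMatrix b : E →* Matrix (Fin 2) (Fin 2) F) l) := rfl

theorem NonsplitTorus.mk_eq_one_iff (l : Eˣ) :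
    (QuotientGroup.mk l : NonsplitTorus F E) = 1 ↔ (l : E) ∈ Set.range (algebraMap F E) := by
  rw [QuotientGroup.eq_one_iff]
  constructor
  · rintro ⟨z, rfl⟩
    exact ⟨z, rfl⟩
  · rintro ⟨z, hz⟩
    have hz0 : z ≠ 0 := by
      rintro rfl
      exact l.ne_zero (by rw [← hz, map_zero])
    exact ⟨Units.mk0 z hz0, Units.ext hz⟩

theorem IsClassFun.apply_ell [FiniteDimensional F E] {φ : PGL2 F → ℂ} (hφ : IsClassFun φ)
    (b : Module.Basis (Fin 2) F E) {l : Eˣ} (hl : (l : E) ∉ Set.range (algebraMap F E)) :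
    φ (PGL2.ell F l) = φ (nonsplitHom b (QuotientGroup.mk l)) := by
  rw [nonsplitHom_mk]
  refine hφ.apply_mk_eq ?_ (leftMulMatrix_ne_scalar b hl) ?_ ?_
  · intro z h
    simpa using congrFun (congrFun h 1) 0
  · change _ = (Algebra.leftMulMatrix b (l : E)).trace
    rw [← Algebra.trace_eq_matrix_trace]
    simp [Matrix.GeneralLinearGroup.mkOfDetNeZero, trace_fin_two]
  · change _ = (Algebra.leftMulMatrix b (l : E)).det
    rw [← Algebra.norm_eq_matrix_det]
    simp [Matrix.GeneralLinearGroup.mkOfDetNeZero, det_fin_two]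

variable [Fintype F] [Fintype E]

theorem card_GL_two : (Nat.card (GL (Fin 2) F) : ℂ) =
    ((Fintype.card F : ℂ) ^ 2 - 1) * ((Fintype.card F : ℂ) ^ 2 - Fintype.card F) := by
  rw [Matrix.card_GL_field, Fin.prod_univ_two]
  have h1 : 1 ≤ Fintype.card F ^ 2 := Nat.one_le_pow _ _ Fintype.card_pos
  have h2 : Fintype.card F ≤ Fintype.card F ^ 2 := Nat.le_self_pow two_ne_zero _
  simp [Nat.cast_sub h1, Nat.cast_sub h2]

theorem card_units_complex (K : Type*) [Field K] [Fintype K] :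
    (Nat.card Kˣ : ℂ) = (Fintype.card K : ℂ) - 1 := by
  classical
  rw [Nat.card_eq_fintype_card, Fintype.card_units, Nat.cast_sub Fintype.card_pos, Nat.cast_one]

theorem sum_units_eq {K : Type*} [Field K] [Fintype K] [Fintype Kˣ] (f : K → ℂ) (hf : f 0 = 0) :
    ∑ x : Kˣ, f x = ∑ x, f x := by
  refine Fintype.sum_of_injective Units.val Units.val_injective _ _ ?_ fun _ => rfl
  intro x hx
  by_cases h : x = 0
  · rw [h, hf]
  · exact absurd ⟨Units.mk0 x h, rfl⟩ hx

theorem card_eq_sq_of_finrank_eq_two (hE : Module.finrank F E = 2) :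
    Fintype.card E = Fintype.card F ^ 2 := by
  have := Module.card_eq_pow_finrank (K := F) (V := E)
  rwa [hE] at this

/-- Weyl integration on the group: `sum_matrix_eq` for the extension of φ by zero, divided by the
order (q² - 1)(q² - q) of GL₂. The torus means include the identity; the last term corrects for this
and for the unipotent class. -/
theorem IsClassFun.avg_eq {φ : PGL2 F → ℂ} (hφ : IsClassFun φ) (b : Module.Basis (Fin 2) F E) :
    avg φ = 1 / 2 * avg (fun x => φ (splitHom F x)) + 1 / 2 * avg (fun t => φ (nonsplitHom b t)) -
      (φ 1 - φ (PGL2.unip F)) / Fintype.card F := by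
  classical
  have hE : Module.finrank F E = 2 := by simpa using Module.finrank_eq_card_basis b
  have hmain := sum_matrix_eq hE b (extendByZero φ) hφ.extendByZero_eq
  set q : ℂ := (Fintype.card F : ℂ) with hq
  have h1 : ∑ M, extendByZero φ M = (q ^ 2 - 1) * (q ^ 2 - q) * avg φ := by
    rw [← avg_comp_surjective (QuotientGroup.mk' (Subgroup.center (GL (Fin 2) F)))
      (QuotientGroup.mk'_surjective _), avg_eq_sum, ← mul_assoc, hq, ← card_GL_two,
      mul_inv_cancel₀ (by simp), one_mul]
    symm
    refine Fintype.sum_of_injective (Units.val (α := Matrix (Fin 2) (Fin 2) F))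
      Units.val_injective _ _ ?_ fun g => (extendByZero_val φ g).symm
    intro M hM
    refine extendByZero_of_det_eq_zero φ ?_
    by_contra h
    exact hM ⟨Matrix.GeneralLinearGroup.mkOfDetNeZero M h, rfl⟩
  have h2 : ∑ x : E, extendByZero φ (Algebra.leftMulMatrix b x) =
      (q ^ 2 - 1) * avg (fun t => φ (nonsplitHom b t)) := by
    have hcard : (Nat.card Eˣ : ℂ) = q ^ 2 - 1 := by
      rw [card_units_complex, card_eq_sq_of_finrank_eq_two hE]
      push_cast
      rfl
    rw [← avg_comp_surjective (QuotientGroup.mk' (Units.map (algebraMap F E : F →* E)).range)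
      (QuotientGroup.mk'_surjective _) (fun t => φ (nonsplitHom b t)), avg_eq_sum, ← mul_assoc,
      ← hcard, mul_inv_cancel₀ (by simp), one_mul, ← sum_units_eq]
    · exact Finset.sum_congr rfl fun l _ => extendByZero_val φ
        (Units.map (Algebra.leftMulMatrix b : E →* Matrix (Fin 2) (Fin 2) F) l)
    · exact extendByZero_of_det_eq_zero φ (by simp)
  have h3 : ∑ p : F × F, extendByZero φ !![p.1, 0; 0, p.2] =
      (q - 1) ^ 2 * avg (fun x => φ (splitHom F x)) := by
    -- Modulo the centre diag(x, y) equals diag(x/y, 1), and all fibres of x/y have the same size.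
    let f : Fˣ × Fˣ →* Fˣ := MonoidHom.fst Fˣ Fˣ / MonoidHom.snd Fˣ Fˣ
    have hf : Function.Surjective f := fun x => ⟨(x, 1), by simp [f]⟩
    have hcard : (Nat.card (Fˣ × Fˣ) : ℂ) = (q - 1) ^ 2 := by
      rw [Nat.card_prod, Nat.cast_mul, card_units_complex, sq]
    rw [← avg_comp_surjective f hf, avg_eq_sum, ← mul_assoc, ← hcard,
      mul_inv_cancel₀ (by simp), one_mul, Fintype.sum_prod_type, Fintype.sum_prod_type,
      ← sum_units_eq]
    · refine Finset.sum_congr rfl fun x _ => ?_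
      rw [← sum_units_eq]
      · refine Finset.sum_congr rfl fun y _ => ?_
        rw [extendByZero_of_det_ne_zero φ (by simp)]
        congr 1
        refine PGL2.mk_eq_mk (y : F) ?_
        ext i j; fin_cases i <;> fin_cases j <;>
          simp [Matrix.GeneralLinearGroup.mkOfDetNeZero, f, mul_div_cancel₀]
      · exact extendByZero_of_det_eq_zero φ (by simp)
    · exact Finset.sum_eq_zero fun y _ => extendByZero_of_det_eq_zero φ (by simp)
  have h4 : ∑ z : F, (extendByZero φ !![z, 1; 0, z] - extendByZero φ !![z, 0; 0, z]) =
      (q - 1) * (φ (PGL2.unip F) - φ 1) := by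
    rw [← sum_units_eq]
    · have (z : Fˣ) : extendByZero φ !![(z : F), 1; 0, (z : F)] -
          extendByZero φ !![(z : F), 0; 0, (z : F)] = φ (PGL2.unip F) - φ 1 := by
        rw [extendByZero_of_det_ne_zero φ (by simp), extendByZero_of_det_ne_zero φ (by simp),
          PGL2.mk_eq_one
            (A := Matrix.GeneralLinearGroup.mkOfDetNeZero !![(z : F), 0; 0, (z : F)] (by simp))
            (z : F) rfl]
        congr 1
        have : φ (PGL2.unip F) = φ (unipHom F (Multiplicative.ofAdd ((z : F)⁻¹))) :=
          (hφ.apply_unipHom (by simp)).symm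
        rw [this]
        congr 1
        refine PGL2.mk_eq_mk (z : F) ?_
        ext i j; fin_cases i <;> fin_cases j <;>
          simp [Matrix.GeneralLinearGroup.mkOfDetNeZero]
      simp only [this]
      rw [Finset.sum_const, nsmul_eq_mul, Finset.card_univ, ← Nat.card_eq_fintype_card,
        card_units_complex]
    · rw [extendByZero_of_det_eq_zero φ (by simp), extendByZero_of_det_eq_zero φ (by simp),
        sub_zero]
  rw [h1, h2, h3, h4] at hmain
  have hq0 : q ≠ 0 := by rw [hq]; simp
  have hqm : q - 1 ≠ 0 := by
    rw [← card_units_complex F]; simp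
  have hqp : q + 1 ≠ 0 := by rw [hq]; exact Nat.cast_add_one_ne_zero _
  have hne : (q ^ 2 - 1) * (q ^ 2 - q) ≠ 0 := by
    rw [show (q ^ 2 - 1) * (q ^ 2 - q) = (q - 1) ^ 2 * (q + 1) * q by ring]
    exact mul_ne_zero (mul_ne_zero (pow_ne_zero _ hqm) hqp) hq0
  apply mul_left_cancel₀ hne
  rw [hmain]
  field_simp
  ring

end ClassFunction

end

noncomputable section

/-! ### Coefficients of class functions -/

section Coefficients

variable {F E : Type*} [Field F] [Fintype F] [Field E] [Fintype E] [Algebra F E]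

omit [Fintype F] [Fintype E] in
theorem finrank_eq_two_of_basis (b : Module.Basis (Fin 2) F E) : Module.finrank F E = 2 := by
  simpa using Module.finrank_eq_card_basis b

theorem card_nonsplitTorus (hE : Module.finrank F E = 2) :
    (Nat.card (NonsplitTorus F E) : ℂ) = (Fintype.card F : ℂ) + 1 := by
  have h := Subgroup.card_eq_card_quotient_mul_card_subgroup
    (Units.map (algebraMap F E : F →* E)).range
  have hinj : Function.Injective (Units.map (algebraMap F E : F →* E)) :=
    Units.map_injective (algebraMap F E).injective
  rw [← Nat.card_congr (MonoidHom.ofInjective hinj).toEquiv] at h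
  have h' := congrArg (Nat.cast : ℕ → ℂ) h
  rw [Nat.cast_mul, card_units_complex, card_units_complex, card_eq_sq_of_finrank_eq_two hE] at h'
  have hqm : (Fintype.card F : ℂ) - 1 ≠ 0 := by
    rw [← card_units_complex F, Nat.cast_ne_zero]
    exact Nat.card_pos.ne'
  apply mul_right_cancel₀ hqm
  rw [← h']
  push_cast
  ring

/-- The multiplicity of a nontrivial character of the unipotent subgroup. -/
def unipCoeff (φ : PGL2 F → ℂ) : ℂ := (φ 1 - φ (PGL2.unip F)) / Fintype.card F

/-- Normalised Fourier coefficients of a function along the two tori. -/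
def coeffs (b : Module.Basis (Fin 2) F E) (φ : PGL2 F → ℂ) :
    Dual Fˣ ⊕ Dual (NonsplitTorus F E) → ℂ :=
  Sum.elim (fun α => fcoeff (fun x => φ (splitHom F x)) α - unipCoeff φ)
    (fun θ => unipCoeff φ - fcoeff (fun t => φ (nonsplitHom b t)) θ)

variable (b : Module.Basis (Fin 2) F E) (φ ψ : PGL2 F → ℂ)

theorem coeffs_inl (α : Dual Fˣ) :
    coeffs b φ (.inl α) = fcoeff (fun x => φ (splitHom F x)) α - unipCoeff φ := rfl

theorem coeffs_inr (θ : Dual (NonsplitTorus F E)) :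
    coeffs b φ (.inr θ) = unipCoeff φ - fcoeff (fun t => φ (nonsplitHom b t)) θ := rfl

theorem apply_unip_eq : φ (PGL2.unip F) = φ 1 - Fintype.card F * unipCoeff φ := by
  have : (Fintype.card F : ℂ) ≠ 0 := by simp
  rw [unipCoeff]
  field_simp
  ring

theorem coeffs_add (j) : coeffs b (fun g => φ g + ψ g) j = coeffs b φ j + coeffs b ψ j := by
  rcases j with α | θ <;> simp only [coeffs_inl, coeffs_inr, unipCoeff, fcoeff, add_mul, avg_add] <;>
    ring

theorem sum_coeffs_inl :
    ∑ α, coeffs b φ (.inl α) = φ 1 - ((Fintype.card F : ℂ) - 1) * unipCoeff φ := by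
  simp only [coeffs_inl, Finset.sum_sub_distrib, sum_fcoeff, map_one, Finset.sum_const,
    Finset.card_univ, nsmul_eq_mul, Dual.card_eq, card_units_complex]

theorem sum_coeffs_inr :
    ∑ θ, coeffs b φ (.inr θ) = ((Fintype.card F : ℂ) + 1) * unipCoeff φ - φ 1 := by
  simp only [coeffs_inr, Finset.sum_sub_distrib, sum_fcoeff, map_one, Finset.sum_const,
    Finset.card_univ, nsmul_eq_mul, Dual.card_eq, card_nonsplitTorus (finrank_eq_two_of_basis b)]

/-- The terms φ 1 of the two tori cancel, leaving (q+1)k - (q-1)k = 2k. -/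
theorem unipCoeff_eq_sum_coeffs : unipCoeff φ = (∑ j, coeffs b φ j) / 2 := by
  rw [Fintype.sum_sum_type, sum_coeffs_inl, sum_coeffs_inr]
  ring

theorem apply_one_eq_sum_coeffs : φ 1 =
    ∑ α, coeffs b φ (.inl α) + ((Fintype.card F : ℂ) - 1) * unipCoeff φ := by
  rw [sum_coeffs_inl]
  ring

/-- Away from the identity the shift by `unipCoeff` is invisible, because the values of all
characters at x sum to zero. -/
theorem apply_splitHom {x : Fˣ} (hx : x ≠ 1) :
    φ (splitHom F x) = ∑ α, coeffs b φ (.inl α) * α.ev x := by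
  classical
  simp only [coeffs_inl, sub_mul, Finset.sum_sub_distrib, ← Finset.mul_sum, Dual.sum_ev, if_neg hx,
    sum_fcoeff_mul_ev, mul_zero, sub_zero]

theorem apply_nonsplitHom {t : NonsplitTorus F E} (ht : t ≠ 1) :
    φ (nonsplitHom b t) = -∑ θ, coeffs b φ (.inr θ) * θ.ev t := by
  classical
  simp only [coeffs_inr, sub_mul, Finset.sum_sub_distrib, ← Finset.mul_sum, Dual.sum_ev, if_neg ht,
    sum_fcoeff_mul_ev, mul_zero, zero_sub, neg_neg]

variable {φ ψ}

/-- This is what the shift is for. Write k, k' for the two `unipCoeff`s. Parseval on both tori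
leaves the correction -(φ 1 k' + ψ 1 k) + q k k'; expanding the shifted products produces precisely
this, with (q-1)/2 + (q+1)/2 = q. -/
theorem IsClassFun.avg_mul_inv (hφ : IsClassFun φ) (hψ : IsClassFun ψ) :
    avg (fun g => φ g * ψ g⁻¹) = (∑ j, coeffs b φ j * coeffs b ψ j) / 2 := by
  have hφψ : IsClassFun (fun g => φ g * ψ g⁻¹) := fun g h => by
    simp only [mul_inv_rev, inv_inv]
    rw [hφ, ← mul_assoc, hψ]
  rw [hφψ.avg_eq b]
  have h1 := avg_mul_eq_sum_fcoeff (fun x => φ (splitHom F x)) (fun x => ψ (splitHom F x))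
  have h2 := avg_mul_eq_sum_fcoeff (fun t => φ (nonsplitHom b t)) (fun t => ψ (nonsplitHom b t))
  simp only [map_inv] at h1 h2
  rw [h1, h2, inv_one, hψ.apply_inv, Fintype.sum_sum_type]
  have e1 : ∑ α, coeffs b φ (.inl α) * coeffs b ψ (.inl α) =
      ∑ α, fcoeff (fun x => φ (splitHom F x)) α * fcoeff (fun x => ψ (splitHom F x)) α -
        φ 1 * unipCoeff ψ - ψ 1 * unipCoeff φ +
        ((Fintype.card F : ℂ) - 1) * (unipCoeff φ * unipCoeff ψ) := by
    simp only [coeffs_inl, sub_mul, mul_sub, Finset.sum_sub_distrib, ← Finset.mul_sum,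
      ← Finset.sum_mul, sum_fcoeff, map_one, Finset.sum_const, Finset.card_univ, nsmul_eq_mul,
      Dual.card_eq, card_units_complex]
    ring
  have e2 : ∑ θ, coeffs b φ (.inr θ) * coeffs b ψ (.inr θ) =
      ∑ θ, fcoeff (fun t => φ (nonsplitHom b t)) θ * fcoeff (fun t => ψ (nonsplitHom b t)) θ -
        φ 1 * unipCoeff ψ - ψ 1 * unipCoeff φ +
        ((Fintype.card F : ℂ) + 1) * (unipCoeff φ * unipCoeff ψ) := by
    simp only [coeffs_inr, sub_mul, mul_sub, Finset.sum_sub_distrib, ← Finset.mul_sum,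
      ← Finset.sum_mul, sum_fcoeff, map_one, Finset.sum_const, Finset.card_univ, nsmul_eq_mul,
      Dual.card_eq, card_nonsplitTorus (finrank_eq_two_of_basis b)]
    ring
  have hq : (Fintype.card F : ℂ) ≠ 0 := by simp
  rw [e1, e2, apply_unip_eq φ, apply_unip_eq ψ]
  field_simp
  ring

theorem IsClassFun.coeffs_inl_neg (hφ : IsClassFun φ) (α : Dual Fˣ) :
    coeffs b φ (.inl (-α)) = coeffs b φ (.inl α) := by
  rw [coeffs_inl, coeffs_inl, fcoeff_neg]
  intro x
  rw [map_inv, hφ.apply_inv]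

theorem IsClassFun.coeffs_inr_neg (hφ : IsClassFun φ) (θ : Dual (NonsplitTorus F E)) :
    coeffs b φ (.inr (-θ)) = coeffs b φ (.inr θ) := by
  rw [coeffs_inr, coeffs_inr, fcoeff_neg]
  intro x
  rw [map_inv, hφ.apply_inv]

/-- All nontrivial elements of the unipotent subgroup are conjugate, so all its nontrivial
characters occur equally often. For a character of the group, `unipCoeff` is thus a multiplicity. -/
theorem IsClassFun.fcoeff_unipHom (hφ : IsClassFun φ) {η : Dual (Multiplicative F)} (hη : η ≠ 0) :
    fcoeff (fun y => φ (unipHom F y)) η = unipCoeff φ := by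
  classical
  have h (y : Multiplicative F) : φ (unipHom F y) * η.ev y⁻¹ =
      φ (PGL2.unip F) * (-η).ev y + if y = 1 then φ 1 - φ (PGL2.unip F) else 0 := by
    split_ifs with hy
    · simp [hy]
    · simp [hφ.apply_unipHom hy]
  simp only [fcoeff, h, avg_add, avg_const_mul, Dual.avg_ev, neg_eq_zero, if_neg hη]
  rw [avg_eq_sum, unipCoeff]
  simp [Nat.card_eq_fintype_card, div_eq_inv_mul]

theorem exists_dual_multiplicative_ne_zero : ∃ η : Dual (Multiplicative F), η ≠ 0 := by
  have : Nontrivial (Dual (Multiplicative F)) := by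
    rw [← Fintype.one_lt_card_iff_nontrivial]
    have h := Dual.card_eq (A := Multiplicative F)
    rw [Nat.cast_inj] at h
    rw [h, Nat.card_eq_fintype_card, Fintype.card_multiplicative]
    exact Fintype.one_lt_card
  exact exists_ne 0

theorem isClassFun_character {G V : Type*} [Group G] [AddCommGroup V] [Module ℂ V]
    (ρ : Representation ℂ G V) : IsClassFun ρ.character :=
  fun g h => ρ.char_conj g h

theorem exists_int_coeffs_character {V : Type*} [AddCommGroup V] [Module ℂ V]
    [FiniteDimensional ℂ V] (ρ : Representation ℂ (PGL2 F) V) (j) :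
    ∃ z : ℤ, coeffs b ρ.character j = z := by
  obtain ⟨η, hη⟩ := exists_dual_multiplicative_ne_zero (F := F)
  obtain ⟨k, hk⟩ := exists_nat_fcoeff_character ρ (unipHom F) η
  rw [(isClassFun_character ρ).fcoeff_unipHom hη] at hk
  rcases j with α | θ
  · obtain ⟨n, hn⟩ := exists_nat_fcoeff_character ρ (splitHom F) α
    exact ⟨n - k, by rw [coeffs_inl, hn, hk]; push_cast; rfl⟩
  · obtain ⟨n, hn⟩ := exists_nat_fcoeff_character ρ (nonsplitHom b) θ
    exact ⟨k - n, by rw [coeffs_inr, hn, hk]; push_cast; rfl⟩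

/-! ### The characters of order two -/

/-- The one-dimensional character of `PGL(2, F)` attached to a quadratic character of `Fˣ`. -/
def detSign (α : Dual Fˣ) (hα : -α = α) : PGL2 F →* ℂ :=
  QuotientGroup.lift _ (α.ev.comp Matrix.GeneralLinearGroup.det) (by
    intro g hg
    rw [Matrix.GeneralLinearGroup.center_eq_range_scalar] at hg
    obtain ⟨z, rfl⟩ := hg
    have h1 : Matrix.GeneralLinearGroup.det (Matrix.GeneralLinearGroup.scalar (Fin 2) z) =
        z * z := by
      ext
      simp [sq]
    have h2 := α.ev_mul_ev_inv z
    rw [← Dual.ev_neg, hα, ← map_mul] at h2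
    change α.ev (Matrix.GeneralLinearGroup.det _) = 1
    rw [h1, h2])

theorem detSign_mk (α : Dual Fˣ) (hα : -α = α) (g : GL (Fin 2) F) :
    detSign α hα (QuotientGroup.mk g) = α.ev (Matrix.GeneralLinearGroup.det g) := rfl

theorem detSign_splitHom (α : Dual Fˣ) (hα : -α = α) (x : Fˣ) :
    detSign α hα (splitHom F x) = α.ev x := by
  change detSign α hα (PGL2.diag x) = _
  rw [PGL2.diag, detSign_mk]
  congr 1
  ext
  simp [Matrix.GeneralLinearGroup.mkOfDetNeZero]

theorem detSign_unip (α : Dual Fˣ) (hα : -α = α) :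
    detSign α hα (PGL2.unip F) = 1 := by
  rw [PGL2.unip, detSign_mk, ← map_one α.ev]
  congr 1
  ext
  simp [Matrix.GeneralLinearGroup.mkOfDetNeZero]

theorem isClassFun_detSign (α : Dual Fˣ) (hα : -α = α) : IsClassFun (detSign α hα) := fun g h => by
  rw [map_mul, map_mul, mul_right_comm, ← map_mul, mul_inv_cancel, map_one, one_mul]

/-- The composition of a quadratic character of `Fˣ` with the norm, on `Eˣ / Fˣ`. -/
def normPull (α : Dual Fˣ) (hα : -α = α) : Dual (NonsplitTorus F E) :=
  Dual.mk ((detSign α hα).comp (nonsplitHom b))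

theorem normPull_ev_mk (α : Dual Fˣ) (hα : -α = α) (l : Eˣ) :
    (normPull b α hα).ev (QuotientGroup.mk l) = α.ev (Units.map (Algebra.norm F) l) := by
  rw [normPull, Dual.ev_mk, MonoidHom.comp_apply, nonsplitHom_mk, detSign_mk]
  congr 1
  ext
  simp [Algebra.norm_eq_matrix_det b]

theorem neg_normPull (α : Dual Fˣ) (hα : -α = α) : -normPull b α hα = normPull b α hα := by
  refine Dual.ext_ev fun t => ?_
  rw [Dual.ev_neg]
  simp only [normPull, Dual.ev_mk, MonoidHom.comp_apply]
  rw [map_inv, (isClassFun_detSign α hα).apply_inv]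

theorem coeffs_detSign [DecidableEq (Dual Fˣ)] [DecidableEq (Dual (NonsplitTorus F E))]
    (α : Dual Fˣ) (hα : -α = α) (j) :
    coeffs b (detSign α hα) j = Sum.elim (fun β => if β = α then (1 : ℂ) else 0)
      (fun θ => if θ = normPull b α hα then -1 else 0) j := by
  have hk : unipCoeff (detSign α hα) = 0 := by simp [unipCoeff, detSign_unip]
  rcases j with β | θ
  · rw [coeffs_inl, hk, sub_zero]
    simp only [detSign_splitHom, Sum.elim_inl]
    exact fcoeff_ev α β
  · rw [coeffs_inr, hk, zero_sub]
    have := fcoeff_ev (normPull b α hα) θ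
    simp only [Sum.elim_inr]
    rw [← neg_zero, ← apply_ite Neg.neg, ← this]
    rfl

/-- The quantity is the pairing of ρ with `detSign α`, whose coefficients are 1 at α and -1 at its
pullback by the norm. It is therefore the multiplicity of `detSign α` in ρ. -/
theorem exists_nat_coeffs_sub_coeffs_normPull {V : Type*} [AddCommGroup V] [Module ℂ V]
    [FiniteDimensional ℂ V] (ρ : Representation ℂ (PGL2 F) V) (α : Dual Fˣ) (hα : -α = α) :
    ∃ n : ℕ, (coeffs b ρ.character (.inl α) -
      coeffs b ρ.character (.inr (normPull b α hα))) / 2 = n := by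
  classical
  obtain ⟨n, hn⟩ := exists_nat_avg_character_mul ρ (MonoidHom.id _) (detSign α hα)
  refine ⟨n, ?_⟩
  rw [← hn]
  have := (isClassFun_character ρ).avg_mul_inv b (isClassFun_detSign α hα)
  simp only [(isClassFun_detSign α hα).apply_inv, coeffs_detSign, Fintype.sum_sum_type,
    Sum.elim_inl, Sum.elim_inr] at this
  simp only [MonoidHom.id_apply, this]
  simp [sub_eq_add_neg]

end Coefficients

end

noncomputable section

/-! ### Irreducible constituents -/

section Constituents

variable {G : Type*} [Group G]

/-- The class of an irreducible representation on an arbitrary space. -/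
theorem exists_irrClass_character_eq {V : Type*} [AddCommGroup V] [Module ℂ V]
    [FiniteDimensional ℂ V] (ρ : Representation ℂ G V) (hρ : ρ.IsIrreducible) :
    ∃ π : IrrClass G, π.character = ρ.character := by
  let e := (Module.finBasis ℂ V).equivFun
  let σ : Representation ℂ G (Fin (Module.finrank ℂ V) → ℂ) :=
    { toFun := fun g => e.conj (ρ g)
      map_one' := by simp [Module.End.one_eq_id]
      map_mul' := fun g h => by simp [Module.End.mul_eq_comp, LinearEquiv.conj_comp] }
  have hσ : σ.IsIrreducible := by
    have hmem (g : G) (v : V) : e (ρ g v) = σ g (e v) := by simp [σ]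
    let i : Subrepresentation σ ≃o Subrepresentation ρ :=
      { toFun := fun W => ⟨W.toSubmodule.comap e.toLinearMap, fun g v hv => by
          simp only [Submodule.mem_comap, LinearEquiv.coe_coe] at hv ⊢
          rw [hmem]
          exact W.apply_mem_toSubmodule g hv⟩
        invFun := fun W => ⟨W.toSubmodule.comap e.symm.toLinearMap, fun g v hv => by
          simp only [Submodule.mem_comap, LinearEquiv.coe_coe] at hv ⊢
          have := hmem g (e.symm v)
          rw [e.apply_symm_apply] at this
          rw [← this, e.symm_apply_apply]
          exact W.apply_mem_toSubmodule g hv⟩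
        left_inv := fun W => Subrepresentation.ext (by ext v; simp)
        right_inv := fun W => Subrepresentation.ext (by ext v; simp)
        map_rel_iff' := by
          intro W W'
          constructor
          · intro h v hv
            have h1 : e (e.symm v) ∈ W'.toSubmodule :=
              @h (e.symm v) (show e (e.symm v) ∈ W.toSubmodule by rwa [e.apply_symm_apply])
            rwa [e.apply_symm_apply] at h1
          · intro h v hv
            exact h hv }
    exact i.isSimpleOrder_iff.mpr hρ
  exact ⟨Quotient.mk (IrrRep.isoSetoid G) ⟨_, σ, hσ⟩,
    funext fun g => LinearMap.trace_conj' (ρ g) e⟩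

theorem Subrepresentation.character_add_of_isCompl {V : Type*} [AddCommGroup V] [Module ℂ V]
    [FiniteDimensional ℂ V] (ρ : Representation ℂ G V) {W W' : Subrepresentation ρ}
    (h : IsCompl W.toSubmodule W'.toSubmodule) (g : G) :
    ρ.character g = W.toRepresentation.character g + W'.toRepresentation.character g := by
  let e := Submodule.prodEquivOfIsCompl _ _ h
  rw [Representation.character, Representation.character, Representation.character,
    ← LinearMap.trace_prodMap', ← LinearMap.trace_conj' _ e]
  congr 1
  ext v
  obtain ⟨⟨w, w'⟩, rfl⟩ := e.surjective v
  simp [e, LinearEquiv.conj_apply, Subrepresentation.toRepresentation]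

/-- By Maschke a reducible representation splits into two smaller ones; an additive functional
nonzero on the sum is nonzero on a summand. Induct on the dimension. -/
theorem exists_irrClass_ne_zero_of_additive [Finite G] (Λ : (G → ℂ) → ℂ)
    (hΛ : ∀ φ ψ, Λ (fun g => φ g + ψ g) = Λ φ + Λ ψ) (n : ℕ) :
    ∀ {V : Type*} [AddCommGroup V] [Module ℂ V] [FiniteDimensional ℂ V]
      (ρ : Representation ℂ G V), Module.finrank ℂ V = n → Λ ρ.character ≠ 0 →
      ∃ π : IrrClass G, Λ π.character ≠ 0 := by
  induction n using Nat.strong_induction_on with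
  | _ n ih =>
    intro V _ _ _ ρ hn hne
    by_cases hirr : ρ.IsIrreducible
    · obtain ⟨π, hπ⟩ := exists_irrClass_character_eq ρ hirr
      exact ⟨π, by rwa [hπ]⟩
    have hnt : Nontrivial (Subrepresentation ρ) := by
      by_contra h
      rw [not_nontrivial_iff_subsingleton] at h
      have hV : (⊥ : Submodule ℂ V) = ⊤ :=
        congrArg Subrepresentation.toSubmodule (Subsingleton.elim (⊥ : Subrepresentation ρ) ⊤)
      have : Subsingleton V := by
        rw [← Submodule.subsingleton_iff ℂ]
        exact subsingleton_of_bot_eq_top hV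
      -- On the zero space the character vanishes, and additivity forces Λ to vanish at the zero
      -- function.
      have h0 : ρ.character = fun _ => 0 := by
        ext g
        rw [Representation.character, Subsingleton.elim (ρ g) 0, map_zero]
      have h1 := hΛ (fun _ => 0) (fun _ => 0)
      simp only [add_zero] at h1
      rw [h0] at hne
      exact hne (by linear_combination -h1)
    obtain ⟨W, hW⟩ : ∃ W : Subrepresentation ρ, ¬(W = ⊥ ∨ W = ⊤) := by
      by_contra! h
      exact hirr ⟨h⟩
    push Not at hW
    obtain ⟨W', hW'⟩ : ∃ W' : Subrepresentation ρ, IsCompl W.toSubmodule W'.toSubmodule := by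
      have : ComplementedLattice (Subrepresentation ρ) :=
        (ρ.isSemisimpleRepresentation_iff_isSemisimpleModule_asModule).mpr inferInstance
      obtain ⟨W', h⟩ := exists_isCompl W
      refine ⟨W', ?_, ?_⟩
      · rw [disjoint_iff]
        exact congrArg Subrepresentation.toSubmodule (disjoint_iff.mp h.1)
      · rw [codisjoint_iff]
        exact congrArg Subrepresentation.toSubmodule (codisjoint_iff.mp h.2)
    have hsum := Submodule.finrank_add_eq_of_isCompl hW'
    have hpos : 0 < Module.finrank ℂ W.toSubmodule := by
      rw [Module.finrank_pos_iff, Submodule.nontrivial_iff_ne_bot]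
      exact fun h => hW.1 (Subrepresentation.toSubmodule_injective h)
    have hlt : Module.finrank ℂ W.toSubmodule < Module.finrank ℂ V :=
      Submodule.finrank_lt fun h => hW.2 (Subrepresentation.toSubmodule_injective h)
    have hchar : ρ.character = fun g => W.toRepresentation.character g +
        W'.toRepresentation.character g :=
      funext fun g => Subrepresentation.character_add_of_isCompl ρ hW' g
    rw [hchar, hΛ] at hne
    by_cases h1 : Λ W.toRepresentation.character = 0
    · rw [h1, zero_add] at hne
      exact ih _ (by omega) W'.toRepresentation rfl hne
    · exact ih _ (by omega) W.toRepresentation rfl h1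

theorem exists_character_eq_regular [Finite G] [DecidableEq G] :
    ∃ ρ : Representation ℂ G (G → ℂ),
      ρ.character = fun g => if g = 1 then (Nat.card G : ℂ) else 0 := by
  cases nonempty_fintype G
  let ρ : Representation ℂ G (G → ℂ) :=
    { toFun := fun g => LinearMap.funLeft ℂ ℂ (fun x => g⁻¹ * x)
      map_one' := by ext f; simp [LinearMap.funLeft]
      map_mul' := fun g h => by ext f; simp [LinearMap.funLeft, mul_assoc] }
  refine ⟨ρ, funext fun g => ?_⟩
  rw [Representation.character, LinearMap.trace_eq_matrix_trace ℂ (Pi.basisFun ℂ G), Matrix.trace]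
  simp only [Matrix.diag_apply, LinearMap.toMatrix_apply, Pi.basisFun_apply, Pi.basisFun_repr]
  split_ifs with hg
  · simp [ρ, hg, Nat.card_eq_fintype_card]
  · refine Finset.sum_eq_zero fun x _ => ?_
    simp [ρ, LinearMap.funLeft_apply, hg]

theorem exists_irrClass_ne_zero [Finite G] [DecidableEq G] (Λ : (G → ℂ) → ℂ)
    (hΛ : ∀ φ ψ, Λ (fun g => φ g + ψ g) = Λ φ + Λ ψ)
    (hreg : Λ (fun g => if g = 1 then (Nat.card G : ℂ) else 0) ≠ 0) :
    ∃ π : IrrClass G, Λ π.character ≠ 0 := by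
  obtain ⟨ρ, hρ⟩ := exists_character_eq_regular (G := G)
  exact exists_irrClass_ne_zero_of_additive Λ hΛ _ ρ rfl (by rwa [hρ])

theorem IrrClass.exists_rep (π : IrrClass G) : ∃ ρ : IrrRep G,
    π = Quotient.mk (IrrRep.isoSetoid G) ρ ∧ π.character = ρ.rho.character ∧ π.dim = ρ.dim := by
  obtain ⟨ρ, rfl⟩ := Quotient.exists_rep (s := IrrRep.isoSetoid G) π
  exact ⟨ρ, rfl, rfl, rfl⟩

theorem IrrClass.isClassFun_character (π : IrrClass G) : IsClassFun π.character := by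
  obtain ⟨ρ, -, h, -⟩ := π.exists_rep
  rw [h]
  exact _root_.isClassFun_character ρ.rho

theorem IrrClass.character_one (π : IrrClass G) : π.character 1 = π.dim := by
  obtain ⟨ρ, -, h, h'⟩ := π.exists_rep
  rw [h, h', Representation.char_one]
  simp

open scoped Classical in
theorem IrrClass.avg_character_mul_inv [Finite G] (π π' : IrrClass G) :
    avg (fun g => π.character g * π'.character g⁻¹) = if π = π' then 1 else 0 := by
  cases nonempty_fintype G
  obtain ⟨ρ, rfl, h, -⟩ := π.exists_rep
  obtain ⟨ρ', rfl, h', -⟩ := π'.exists_rep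
  have : Invertible (Nat.card G : ℂ) := invertibleOfNonzero (by simp)
  have := ρ.irr
  have := ρ'.irr
  rw [avg_eq_sum, h, h', Representation.char_orthonormal]
  refine if_congr ?_ rfl rfl
  exact (Quotient.eq (r := IrrRep.isoSetoid G)).symm.trans eq_comm

end Constituents

end

noncomputable section

/-! ### Quadratic characters -/

section Quadratic

theorem Dual.ev_sq_eq_one {A : Type*} [CommGroup A] {α : Dual A} (hα : -α = α) (x : A) :
    α.ev x ^ 2 = 1 := by
  have h := α.ev_mul_ev_inv x
  rwa [← Dual.ev_neg, hα, ← sq] at h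

theorem Dual.eq_zero_of_odd_card {A : Type*} [CommGroup A] [Finite A] (hA : Odd (Nat.card A))
    {α : Dual A} (hα : -α = α) : α = 0 := by
  refine Dual.ext_ev fun x => ?_
  obtain ⟨m, hm⟩ := hA
  have h1 : α.ev x ^ (2 * m + 1) = 1 := by
    rw [← hm, ← map_pow, pow_card_eq_one', map_one]
  rw [pow_succ, pow_mul, Dual.ev_sq_eq_one hα, one_pow, one_mul] at h1
  rw [h1, Dual.ev_zero]

/-- A nontrivial character with values ±1 must take the value -1 at a generator, which determines
it. -/
theorem Dual.eq_of_quadratic {A : Type*} [CommGroup A] [Finite A] [IsCyclic A] {α β : Dual A}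
    (hα : -α = α) (hβ : -β = β) (hα0 : α ≠ 0) (hβ0 : β ≠ 0) : α = β := by
  obtain ⟨g, hg⟩ := IsCyclic.exists_monoid_generator (α := A)
  have hext {γ δ : Dual A} (h : γ.ev g = δ.ev g) : γ = δ := by
    refine Dual.ext_ev fun x => ?_
    obtain ⟨n, rfl⟩ := Submonoid.mem_powers_iff _ _ |>.mp (hg x)
    rw [map_pow, map_pow, h]
  have hneg {γ : Dual A} (hγ : -γ = γ) (hγ0 : γ ≠ 0) : γ.ev g = -1 := by
    refine (sq_eq_one_iff.mp (Dual.ev_sq_eq_one hγ g)).resolve_left fun h => ?_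
    exact hγ0 (hext (by rw [h, Dual.ev_zero]))
  exact hext (by rw [hneg hα hα0, hneg hβ hβ0])

variable {F E : Type*} [Field F] [Fintype F] [Field E] [Fintype E] [Algebra F E]

instance : IsCyclic (NonsplitTorus F E) :=
  isCyclic_of_surjective (QuotientGroup.mk' _) (QuotientGroup.mk'_surjective _)

theorem odd_card_units (hq : Even (Fintype.card F)) : Odd (Nat.card Fˣ) := by
  classical
  rw [Nat.card_eq_fintype_card, Fintype.card_units]
  exact Nat.Even.sub_odd Fintype.card_pos hq odd_one

theorem odd_card_nonsplitTorus (hE : Module.finrank F E = 2) (hq : Even (Fintype.card F)) :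
    Odd (Nat.card (NonsplitTorus F E)) := by
  have h := card_nonsplitTorus hE
  rw [show Nat.card (NonsplitTorus F E) = Fintype.card F + 1 by exact_mod_cast h]
  exact hq.add_one

/-- The quadratic character of `Fˣ`. -/
def quadDual (K : Type*) [Field K] [Fintype K] [DecidableEq K] : Dual Kˣ :=
  Dual.mk
    { toFun := fun x => quadSign (x : K)
      map_one' := by simp [quadSign]
      map_mul' := fun x y => by simp [quadSign, -quadraticChar_apply] }

theorem quadDual_ev (K : Type*) [Field K] [Fintype K] [DecidableEq K] (x : Kˣ) :
    (quadDual K).ev x = quadSign (x : K) := rfl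

theorem neg_quadDual (K : Type*) [Field K] [Fintype K] [DecidableEq K] :
    -quadDual K = quadDual K := by
  refine Dual.ext_ev fun x => ?_
  have h1 := (quadDual K).ev_mul_ev_inv x
  have h2 : (quadDual K).ev x ^ 2 = 1 := by
    rw [quadDual_ev, quadSign]
    exact_mod_cast quadraticChar_sq_one x.ne_zero
  have h3 : (quadDual K).ev x ≠ 0 := left_ne_zero_of_mul_eq_one h1
  rw [Dual.ev_neg]
  apply mul_left_cancel₀ h3
  rw [h1, ← h2, sq]

theorem ringChar_ne_two_of_odd_card {K : Type*} [Field K] [Fintype K]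
    (hq : Odd (Fintype.card K)) : ringChar K ≠ 2 := fun h =>
  (Nat.not_even_iff_odd.mpr hq) (FiniteField.even_card_iff_char_two.mp h |> Nat.even_iff.mpr)

theorem quadDual_ne_zero (K : Type*) [Field K] [Fintype K] [DecidableEq K]
    (hq : Odd (Fintype.card K)) : quadDual K ≠ 0 := by
  intro h
  obtain ⟨a, ha⟩ := quadraticChar_exists_neg_one' (ringChar_ne_two_of_odd_card hq)
  have h1 : (quadDual K).ev a = 1 := by rw [h, Dual.ev_zero]
  rw [quadDual_ev, quadSign, ha] at h1
  norm_num at h1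

variable (b : Module.Basis (Fin 2) F E)

theorem normPull_zero : normPull b 0 neg_zero = 0 := by
  refine Dual.ext_ev fun t => ?_
  obtain ⟨l, rfl⟩ := QuotientGroup.mk_surjective t
  rw [normPull_ev_mk, Dual.ev_zero, Dual.ev_zero]

theorem normPull_injective {α β : Dual Fˣ} (hα : -α = α) (hβ : -β = β)
    (h : normPull b α hα = normPull b β hβ) : α = β := by
  refine Dual.ext_ev fun x => ?_
  obtain ⟨l, rfl⟩ := FiniteField.unitsMap_norm_surjective F E x
  rw [← normPull_ev_mk b α hα, ← normPull_ev_mk b β hβ, h]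

theorem eq_zero_or_eq_quadDual [DecidableEq F] {α : Dual Fˣ} (hq : Odd (Fintype.card F))
    (hα : -α = α) : α = 0 ∨ α = quadDual F := by
  by_cases h : α = 0
  · exact .inl h
  · exact .inr (Dual.eq_of_quadratic hα (neg_quadDual F) h (quadDual_ne_zero F hq))

/-- For q even the group Eˣ/Fˣ has odd order q + 1 and only the trivial character is self-inverse.
For q odd it is cyclic, and ε∘N is its unique nontrivial self-inverse character; nontriviality comes
from surjectivity of the norm. -/
theorem exists_normPull_eq {θ : Dual (NonsplitTorus F E)} (hθ : -θ = θ) :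
    ∃ α, ∃ hα : -α = α, normPull b α hα = θ := by
  classical
  by_cases h0 : θ = 0
  · exact ⟨0, neg_zero, by rw [h0, normPull_zero]⟩
  rcases Nat.even_or_odd (Fintype.card F) with hq | hq
  · exact absurd (Dual.eq_zero_of_odd_card
      (odd_card_nonsplitTorus (finrank_eq_two_of_basis b) hq) hθ) h0
  · refine ⟨quadDual F, neg_quadDual F, Dual.eq_of_quadratic (neg_normPull b _ _) hθ ?_ h0⟩
    intro h
    rw [← normPull_zero b] at h
    exact quadDual_ne_zero F hq (normPull_injective b _ _ h)

/-- Both sides are nontrivial quadratic characters of the cyclic group Eˣ, the left one because the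
norm is surjective. -/
theorem quadSign_norm [DecidableEq F] [DecidableEq E] (hE : Module.finrank F E = 2)
    (hq : Odd (Fintype.card F)) (l : Eˣ) :
    quadSign (Algebra.norm F (l : E)) = quadSign (l : E) := by
  let b : Module.Basis (Fin 2) F E := Module.finBasisOfFinrankEq F E hE
  have hqE : Odd (Fintype.card E) := by
    rw [card_eq_sq_of_finrank_eq_two hE]
    exact hq.pow
  let β : Dual Eˣ := Dual.mk ((normPull b (quadDual F) (neg_quadDual F)).ev.comp
    (QuotientGroup.mk' (Units.map (algebraMap F E : F →* E)).range))
  have hev (x : Eˣ) : β.ev x = quadSign (Algebra.norm F (x : E)) := by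
    change (normPull b (quadDual F) (neg_quadDual F)).ev (QuotientGroup.mk x) = _
    rw [normPull_ev_mk, quadDual_ev]
    rfl
  have hβ : -β = β := by
    refine Dual.ext_ev fun x => ?_
    rw [Dual.ev_neg]
    change (normPull b (quadDual F) (neg_quadDual F)).ev (QuotientGroup.mk x)⁻¹ = _
    rw [← Dual.ev_neg, neg_normPull]
    rfl
  have hβ0 : β ≠ 0 := by
    intro h
    apply quadDual_ne_zero F hq
    refine Dual.ext_ev fun x => ?_
    obtain ⟨l, rfl⟩ := FiniteField.unitsMap_norm_surjective F E x
    rw [quadDual_ev, Dual.ev_zero, ← Dual.ev_zero l, ← h, hev]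
    rfl
  rw [← hev, Dual.eq_of_quadratic hβ (neg_quadDual E) hβ0 (quadDual_ne_zero E hqE), quadDual_ev]

end Quadratic

/-! ### The shapes of irreducible characters -/

section Shapes

variable {F E : Type*} [Field F] [Fintype F] [Field E] [Fintype E] [Algebra F E]
variable (b : Module.Basis (Fin 2) F E)

open scoped Classical in
/-- The coefficients of a principal series character. -/
def principalCoeffs (F E : Type*) [Field F] [Field E] [Algebra F E] (α : Dual Fˣ) :
    Dual Fˣ ⊕ Dual (NonsplitTorus F E) → ℂ :=
  Pi.single (.inl α) 1 + Pi.single (.inl (-α)) 1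

open scoped Classical in
/-- The coefficients of a discrete series character. -/
def discreteCoeffs {F E : Type*} [Field F] [Field E] [Algebra F E]
    (θ : Dual (NonsplitTorus F E)) : Dual Fˣ ⊕ Dual (NonsplitTorus F E) → ℂ :=
  Pi.single (.inr θ) 1 + Pi.single (.inr (-θ)) 1

open scoped Classical in
/-- The coefficients of a twist of the Steinberg character. -/
def steinbergCoeffs (α : Dual Fˣ) (hα : -α = α) :
    Dual Fˣ ⊕ Dual (NonsplitTorus F E) → ℂ :=
  Pi.single (.inl α) 1 + Pi.single (.inr (normPull b α hα)) 1

open scoped Classical in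
/-- The coefficients of a one-dimensional character. -/
def linearCoeffs (α : Dual Fˣ) (hα : -α = α) :
    Dual Fˣ ⊕ Dual (NonsplitTorus F E) → ℂ :=
  Pi.single (.inl α) 1 + Pi.single (.inr (normPull b α hα)) (-1)

variable {b} {φ : PGL2 F → ℂ}

section Principal
variable {α : Dual Fˣ} (h : coeffs b φ = principalCoeffs F E α)
include h

/-- Half the sum of the entries. The same reading gives 1 for the discrete series and Steinberg
shapes, 0 for the linear one; the other values then follow from the inversion formulas for `coeffs`.
-/
theorem unipCoeff_of_principal : unipCoeff φ = 1 := by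
  rw [unipCoeff_eq_sum_coeffs b, h]
  simp [principalCoeffs, Finset.sum_add_distrib, Pi.single_apply]

theorem apply_one_of_principal : φ 1 = Fintype.card F + 1 := by
  rw [apply_one_eq_sum_coeffs b φ, unipCoeff_of_principal h, h]
  simp [principalCoeffs, Finset.sum_add_distrib, Pi.single_apply]
  ring

theorem apply_unip_of_principal : φ (PGL2.unip F) = 1 := by
  rw [apply_unip_eq φ, unipCoeff_of_principal h, apply_one_of_principal h]
  ring

theorem apply_splitHom_of_principal {x : Fˣ} (hx : x ≠ 1) :
    φ (splitHom F x) = α.ev x + α.ev x⁻¹ := by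
  rw [apply_splitHom b φ hx, h]
  simp [principalCoeffs, Finset.sum_add_distrib, Pi.single_apply, add_mul]

theorem apply_nonsplitHom_of_principal {t : NonsplitTorus F E} (ht : t ≠ 1) :
    φ (nonsplitHom b t) = 0 := by
  rw [apply_nonsplitHom b φ ht, h]
  simp [principalCoeffs]

end Principal

section Discrete
variable {θ : Dual (NonsplitTorus F E)} (h : coeffs b φ = discreteCoeffs θ)
include h

theorem unipCoeff_of_discrete : unipCoeff φ = 1 := by
  rw [unipCoeff_eq_sum_coeffs b, h]
  simp [discreteCoeffs, Finset.sum_add_distrib, Pi.single_apply]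

theorem apply_one_of_discrete : φ 1 = Fintype.card F - 1 := by
  rw [apply_one_eq_sum_coeffs b φ, unipCoeff_of_discrete h, h]
  simp [discreteCoeffs]

theorem apply_unip_of_discrete : φ (PGL2.unip F) = -1 := by
  rw [apply_unip_eq φ, unipCoeff_of_discrete h, apply_one_of_discrete h]
  ring

theorem apply_splitHom_of_discrete {x : Fˣ} (hx : x ≠ 1) : φ (splitHom F x) = 0 := by
  rw [apply_splitHom b φ hx, h]
  simp [discreteCoeffs]

theorem apply_nonsplitHom_of_discrete {t : NonsplitTorus F E} (ht : t ≠ 1) :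
    φ (nonsplitHom b t) = -(θ.ev t + θ.ev t⁻¹) := by
  rw [apply_nonsplitHom b φ ht, h]
  simp [discreteCoeffs, Finset.sum_add_distrib, Pi.single_apply, add_mul]

end Discrete

section Steinberg
variable {α : Dual Fˣ} {hα : -α = α} (h : coeffs b φ = steinbergCoeffs b α hα)
include h

theorem unipCoeff_of_steinberg : unipCoeff φ = 1 := by
  rw [unipCoeff_eq_sum_coeffs b, h]
  simp [steinbergCoeffs, Finset.sum_add_distrib, Pi.single_apply]

theorem apply_one_of_steinberg : φ 1 = Fintype.card F := by
  rw [apply_one_eq_sum_coeffs b φ, unipCoeff_of_steinberg h, h]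
  simp [steinbergCoeffs, Pi.single_apply]

theorem apply_unip_of_steinberg : φ (PGL2.unip F) = 0 := by
  rw [apply_unip_eq φ, unipCoeff_of_steinberg h, apply_one_of_steinberg h]
  ring

theorem apply_splitHom_of_steinberg {x : Fˣ} (hx : x ≠ 1) :
    φ (splitHom F x) = α.ev x := by
  rw [apply_splitHom b φ hx, h]
  simp [steinbergCoeffs, Pi.single_apply]

theorem apply_nonsplitHom_of_steinberg {t : NonsplitTorus F E} (ht : t ≠ 1) :
    φ (nonsplitHom b t) = -(normPull b α hα).ev t := by
  rw [apply_nonsplitHom b φ ht, h]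
  simp [steinbergCoeffs, Pi.single_apply]

end Steinberg

section Linear
variable {α : Dual Fˣ} {hα : -α = α} (h : coeffs b φ = linearCoeffs b α hα)
include h

theorem unipCoeff_of_linear : unipCoeff φ = 0 := by
  rw [unipCoeff_eq_sum_coeffs b, h]
  simp [linearCoeffs, Finset.sum_add_distrib, Pi.single_apply]

theorem apply_one_of_linear : φ 1 = 1 := by
  rw [apply_one_eq_sum_coeffs b φ, unipCoeff_of_linear h, h]
  simp [linearCoeffs, Pi.single_apply]

theorem apply_unip_of_linear : φ (PGL2.unip F) = 1 := by
  rw [apply_unip_eq φ, unipCoeff_of_linear h, apply_one_of_linear h]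
  ring

theorem apply_splitHom_of_linear {x : Fˣ} (hx : x ≠ 1) :
    φ (splitHom F x) = α.ev x := by
  rw [apply_splitHom b φ hx, h]
  simp [linearCoeffs, Pi.single_apply]

theorem apply_nonsplitHom_of_linear {t : NonsplitTorus F E} (ht : t ≠ 1) :
    φ (nonsplitHom b t) = (normPull b α hα).ev t := by
  rw [apply_nonsplitHom b φ ht, h]
  simp [linearCoeffs, Pi.single_apply]

end Linear

end Shapes

/-! ### Classification -/

section Classification

theorem exists_pair_of_sum_sq_eq_two {J : Type*} [Fintype J] (z : J → ℤ)
    (h : ∑ j, z j ^ 2 = 2) : ∃ i j, i ≠ j ∧ (z i = 1 ∨ z i = -1) ∧ (z j = 1 ∨ z j = -1) ∧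
      ∀ k, k ≠ i → k ≠ j → z k = 0 := by
  classical
  have hle (j : J) : z j ^ 2 ≤ 2 := by
    rw [← h]
    exact Finset.single_le_sum (fun i _ => sq_nonneg (z i)) (Finset.mem_univ j)
  have hval (j : J) : z j = 0 ∨ z j = 1 ∨ z j = -1 := by
    have h1 : z j < 2 := by nlinarith [hle j]
    have h2 : -2 < z j := by nlinarith [hle j]
    omega
  have hcard : (Finset.univ.filter fun j => z j ≠ 0).card = 2 := by
    have : ∑ j, z j ^ 2 = ((Finset.univ.filter fun j => z j ≠ 0).card : ℤ) := by
      rw [Finset.card_filter]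
      push_cast
      refine Finset.sum_congr rfl fun j _ => ?_
      rcases hval j with h | h | h <;> simp [h]
    rw [h] at this
    exact_mod_cast this.symm
  obtain ⟨i, j, hij, hs⟩ := Finset.card_eq_two.mp hcard
  have hmem (k : J) : z k ≠ 0 ↔ k = i ∨ k = j := by
    have := Finset.ext_iff.mp hs k
    simpa using this
  refine ⟨i, j, hij, (hval i).resolve_left ((hmem i).mpr (.inl rfl)),
    (hval j).resolve_left ((hmem j).mpr (.inr rfl)), fun k hki hkj => ?_⟩
  by_contra hk
  exact ((hmem k).mp hk).elim hki hkj

variable {F E : Type*} [Field F] [Fintype F] [Field E] [Fintype E] [Algebra F E]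
variable (b : Module.Basis (Fin 2) F E)

/-- The pairing depends only on coefficient vectors, so equal vectors would give a pairing of 1
between orthogonal characters. -/
theorem IrrClass.coeffs_injective {π π' : IrrClass (PGL2 F)}
    (h : coeffs b π.character = coeffs b π'.character) : π = π' := by
  classical
  by_contra hne
  have h1 := π.avg_character_mul_inv π'
  have h2 := π.avg_character_mul_inv π
  rw [π.isClassFun_character.avg_mul_inv b π'.isClassFun_character, if_neg hne] at h1
  rw [π.isClassFun_character.avg_mul_inv b π.isClassFun_character, if_pos rfl] at h2
  rw [← h, h2] at h1
  exact one_ne_zero h1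

theorem IrrClass.exists_int_coeffs (π : IrrClass (PGL2 F)) :
    ∃ z : Dual Fˣ ⊕ Dual (NonsplitTorus F E) → ℤ,
      (∀ j, coeffs b π.character j = z j) ∧ ∑ j, z j ^ 2 = 2 := by
  classical
  obtain ⟨ρ, -, h, -⟩ := π.exists_rep
  choose z hz using exists_int_coeffs_character b ρ.rho
  rw [← h] at hz
  refine ⟨z, hz, ?_⟩
  have h1 := π.avg_character_mul_inv π
  rw [π.isClassFun_character.avg_mul_inv b π.isClassFun_character, if_pos rfl] at h1
  simp only [hz, ← sq] at h1
  have h2 : ((∑ j, z j ^ 2 : ℤ) : ℂ) = (2 : ℤ) := by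
    push_cast
    linear_combination 2 * h1
  exact_mod_cast h2

include b in
theorem IrrClass.finite_PGL2 : Finite (IrrClass (PGL2 F)) := by
  have hfin : {c : Dual Fˣ ⊕ Dual (NonsplitTorus F E) → ℂ |
      ∀ j, c j ∈ ({0, 1, -1} : Set ℂ)}.Finite := Set.Finite.pi' fun _ => Set.toFinite _
  have hmem (π : IrrClass (PGL2 F)) (j) : coeffs b π.character j ∈ ({0, 1, -1} : Set ℂ) := by
    obtain ⟨z, hz, hsum⟩ := π.exists_int_coeffs b
    obtain ⟨i, i', -, hi, hi', h⟩ := exists_pair_of_sum_sq_eq_two z hsum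
    have : z j = 0 ∨ z j = 1 ∨ z j = -1 := by
      by_cases h1 : j = i
      · subst h1; exact .inr hi
      · by_cases h2 : j = i'
        · subst h2; exact .inr hi'
        · exact .inl (h j h1 h2)
    rw [hz]
    rcases this with h | h | h <;> simp [h]
  have := hfin.to_subtype
  exact Finite.of_injective (β := {c : Dual Fˣ ⊕ Dual (NonsplitTorus F E) → ℂ |
      ∀ j, c j ∈ ({0, 1, -1} : Set ℂ)}) (fun π => ⟨coeffs b π.character, hmem π⟩)
    fun π π' h => IrrClass.coeffs_injective b (Subtype.ext_iff.mp h)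

open scoped Classical in
-- The two nonzero entries are ±1. If one sits at a character that is not self-inverse, inversion
-- symmetry places the other at the inverse. If it sits at a quadratic α or at α∘N, parity makes the
-- companion entry odd, so that is the other one.
theorem IrrClass.coeffs_character_cases (π : IrrClass (PGL2 F)) :
    (∃ α, -α ≠ α ∧ coeffs b π.character = principalCoeffs F E α) ∨
    (∃ θ, -θ ≠ θ ∧ coeffs b π.character = discreteCoeffs θ) ∨
    (∃ α, ∃ hα : -α = α, coeffs b π.character = steinbergCoeffs b α hα) ∨
    (∃ α, ∃ hα : -α = α, coeffs b π.character = linearCoeffs b α hα) := by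
  obtain ⟨z, hz, hsum⟩ := π.exists_int_coeffs b
  have hinl (α : Dual Fˣ) : z (.inl (-α)) = z (.inl α) := by
    have := π.isClassFun_character.coeffs_inl_neg b α
    rw [hz, hz] at this
    exact_mod_cast this
  have hinr (θ : Dual (NonsplitTorus F E)) : z (.inr (-θ)) = z (.inr θ) := by
    have := π.isClassFun_character.coeffs_inr_neg b θ
    rw [hz, hz] at this
    exact_mod_cast this
  have hpar (α : Dual Fˣ) (hα : -α = α) :
      ∃ n : ℕ, z (.inl α) - z (.inr (normPull b α hα)) = 2 * n := by
    obtain ⟨ρ, -, h, -⟩ := π.exists_rep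
    obtain ⟨n, hn⟩ := exists_nat_coeffs_sub_coeffs_normPull b ρ.rho α hα
    rw [← h, hz, hz] at hn
    refine ⟨n, ?_⟩
    have : ((z (.inl α) - z (.inr (normPull b α hα)) : ℤ) : ℂ) = ((2 * n : ℤ) : ℂ) := by
      push_cast
      linear_combination 2 * hn
    exact_mod_cast this
  -- The value at 1 in terms of the entries. A wrong sign makes the right side negative: -2(q+1) or
  -- -2(q-1) for a pair of inverses, -2 or -2q for a mixed pair.
  have hdim : 2 * (π.dim : ℤ) = ((Fintype.card F : ℤ) + 1) * ∑ α, z (.inl α) +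
      ((Fintype.card F : ℤ) - 1) * ∑ θ, z (.inr θ) := by
    have h1 := apply_one_eq_sum_coeffs b π.character
    rw [unipCoeff_eq_sum_coeffs b, π.character_one, Fintype.sum_sum_type] at h1
    simp only [hz] at h1
    have h2 : ((2 * (π.dim : ℤ) : ℤ) : ℂ) = ((((Fintype.card F : ℤ) + 1) * ∑ α, z (.inl α) +
      ((Fintype.card F : ℤ) - 1) * ∑ θ, z (.inr θ) : ℤ) : ℂ) := by
      push_cast
      linear_combination 2 * h1
    exact_mod_cast h2
  have hq : 1 < (Fintype.card F : ℤ) := by exact_mod_cast Fintype.one_lt_card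
  obtain ⟨i, j, hij, hi, hj, hk⟩ := exists_pair_of_sum_sq_eq_two z hsum
  have hzeq : z = Pi.single i (z i) + Pi.single j (z j) := by
    ext k
    by_cases hki : k = i
    · subst hki; simp [hij]
    · by_cases hkj : k = j
      · subst hkj; simp [hki]
      · simp [hki, hkj, hk]
  have hmem {k} (h : z k ≠ 0) : k = i ∨ k = j := by
    by_contra! h'
    exact h (hk k h'.1 h'.2)
  have hi0 : z i ≠ 0 := by omega
  have hj0 : z j ≠ 0 := by omega
  have hmixed (α : Dual Fˣ) (hα : -α = α)
      (h : z = Pi.single (.inl α) (z (.inl α)) +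
        Pi.single (.inr (normPull b α hα)) (z (.inr (normPull b α hα))))
      (h1 : z (.inl α) = 1 ∨ z (.inl α) = -1) (h2 : z (.inr (normPull b α hα)) = 1 ∨
        z (.inr (normPull b α hα)) = -1) :
      (∃ α, ∃ hα : -α = α, coeffs b π.character = steinbergCoeffs b α hα) ∨
      (∃ α, ∃ hα : -α = α, coeffs b π.character = linearCoeffs b α hα) := by
    have hs1 : ∑ β, z (.inl β) = z (.inl α) := by
      rw [h]; simp [Pi.single_apply]
    have hs2 : ∑ θ, z (.inr θ) = z (.inr (normPull b α hα)) := by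
      rw [h]; simp [Pi.single_apply]
    rw [hs1, hs2] at hdim
    have h1' : z (.inl α) = 1 := by
      refine h1.resolve_right fun h1 => ?_
      rcases h2 with h2 | h2 <;> rw [h1, h2] at hdim <;> omega
    rw [h1'] at h
    rcases h2 with h2 | h2 <;> rw [h2] at h
    · refine .inl ⟨α, hα, funext fun k => ?_⟩
      rw [hz, h, steinbergCoeffs]
      simp [Pi.single_apply]
    · refine .inr ⟨α, hα, funext fun k => ?_⟩
      rw [hz, h, linearCoeffs]
      simp [Pi.single_apply]
  rcases i with α | θ
  · by_cases hα : -α = α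
    · obtain ⟨n, hn⟩ := hpar α hα
      have hne : z (.inr (normPull b α hα)) ≠ 0 := by omega
      obtain rfl := (hmem hne).resolve_left (by simp)
      exact .inr (.inr (hmixed α hα hzeq hi hj))
    · have hne : z (.inl (-α)) ≠ 0 := by rwa [hinl]
      obtain rfl := (hmem hne).resolve_left (by simpa using hα)
      left
      refine ⟨α, hα, funext fun k => ?_⟩
      rw [hinl] at hzeq
      have hs1 : ∑ β, z (.inl β) = 2 * z (.inl α) := by
        rw [hzeq]; simp [Pi.single_apply, Finset.sum_add_distrib, Ne.symm hα]; ring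
      have hs2 : ∑ θ, z (.inr θ) = 0 := by rw [hzeq]; simp
      have h1 : z (.inl α) = 1 := by
        refine hi.resolve_right fun h1 => ?_
        rw [hs1, hs2, h1] at hdim
        omega
      rw [hz, hzeq, h1, principalCoeffs]
      simp [Pi.single_apply]
  · by_cases hθ : -θ = θ
    · obtain ⟨α, hα, rfl⟩ := exists_normPull_eq b hθ
      obtain ⟨n, hn⟩ := hpar α hα
      have hne : z (.inl α) ≠ 0 := by omega
      obtain rfl := (hmem hne).resolve_left (by simp)
      exact .inr (.inr (hmixed α hα (by rw [add_comm]; exact hzeq) hj hi))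
    · have hne : z (.inr (-θ)) ≠ 0 := by rwa [hinr]
      obtain rfl := (hmem hne).resolve_left (by simpa using hθ)
      right; left
      refine ⟨θ, hθ, funext fun k => ?_⟩
      rw [hinr] at hzeq
      have hs1 : ∑ β, z (.inl β) = 0 := by rw [hzeq]; simp
      have hs2 : ∑ η, z (.inr η) = 2 * z (.inr θ) := by
        rw [hzeq]; simp [Pi.single_apply, Finset.sum_add_distrib, Ne.symm hθ]; ring
      have h1 : z (.inr θ) = 1 := by
        refine hi.resolve_right fun h1 => ?_
        rw [hs1, hs2, h1] at hdim
        omega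
      rw [hz, hzeq, h1, discreteCoeffs]
      simp [Pi.single_apply]

end Classification

end

noncomputable section

/-! ### Existence of all shapes and summation over irreducible classes -/

section Existence

variable {F E : Type*} [Field F] [Field E] [Algebra F E]

theorem PGL2.exists_eq_scalar_of_mk_eq_one {A : GL (Fin 2) F}
    (h : (QuotientGroup.mk A : PGL2 F) = 1) :
    ∃ z : F, (A : Matrix (Fin 2) (Fin 2) F) = !![z, 0; 0, z] := by
  rw [QuotientGroup.eq_one_iff,
    Matrix.GeneralLinearGroup.mem_center_iff_val_mem_range_scalar] at h
  obtain ⟨z, hz⟩ := h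
  refine ⟨z, ?_⟩
  rw [← hz]
  ext i j; fin_cases i <;> fin_cases j <;> simp

theorem splitHom_eq_one_iff {x : Fˣ} : splitHom F x = 1 ↔ x = 1 := by
  refine ⟨fun h => ?_, fun h => by rw [h, map_one]⟩
  obtain ⟨z, hz⟩ := PGL2.exists_eq_scalar_of_mk_eq_one h
  have h0 : (x : F) = z := congrFun (congrFun hz 0) 0
  have h1 : (1 : F) = z := congrFun (congrFun hz 1) 1
  exact Units.ext (h0.trans h1.symm)

theorem unip_ne_one : PGL2.unip F ≠ 1 := fun h => by
  obtain ⟨z, hz⟩ := PGL2.exists_eq_scalar_of_mk_eq_one h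
  have h0 : (1 : F) = 0 := congrFun (congrFun hz 0) 1
  exact one_ne_zero h0

theorem nonsplitHom_eq_one_iff (b : Module.Basis (Fin 2) F E) {t : NonsplitTorus F E} :
    nonsplitHom b t = 1 ↔ t = 1 := by
  refine ⟨fun h => ?_, fun h => by rw [h, map_one]⟩
  obtain ⟨l, rfl⟩ := QuotientGroup.mk_surjective t
  rw [nonsplitHom_mk] at h
  obtain ⟨z, hz⟩ := PGL2.exists_eq_scalar_of_mk_eq_one h
  rw [NonsplitTorus.mk_eq_one_iff]
  by_contra hl
  exact leftMulMatrix_ne_scalar b hl z hz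

theorem fcoeff_delta {A : Type*} [CommGroup A] [Finite A] [DecidableEq A] (c : ℂ) (α : Dual A) :
    fcoeff (fun x => if x = 1 then c else 0) α = c / Nat.card A := by
  cases nonempty_fintype A
  rw [fcoeff, avg_eq_sum, Finset.sum_eq_single 1 (by intro x _ hx; simp [hx]) (by simp)]
  simp [div_eq_inv_mul]

variable [Fintype F] [Fintype E] (b : Module.Basis (Fin 2) F E)

theorem unipCoeff_regular [DecidableEq (PGL2 F)] (c : ℂ) :
    unipCoeff (fun g : PGL2 F => if g = 1 then c else 0) = c / Fintype.card F := by
  simp [unipCoeff, unip_ne_one]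

theorem coeffs_regular_inl [DecidableEq (PGL2 F)] (c : ℂ) (α : Dual Fˣ) :
    coeffs b (fun g => if g = 1 then c else 0) (.inl α) =
      c / (Fintype.card F - 1) - c / Fintype.card F := by
  classical
  rw [coeffs_inl, unipCoeff_regular]
  simp only [splitHom_eq_one_iff]
  rw [fcoeff_delta, card_units_complex]

theorem coeffs_regular_inr [DecidableEq (PGL2 F)] (c : ℂ) (θ : Dual (NonsplitTorus F E)) :
    coeffs b (fun g => if g = 1 then c else 0) (.inr θ) =
      c / Fintype.card F - c / (Fintype.card F + 1) := by
  classical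
  rw [coeffs_inr, unipCoeff_regular]
  simp only [nonsplitHom_eq_one_iff]
  rw [fcoeff_delta, card_nonsplitTorus (finrank_eq_two_of_basis b)]

theorem card_sub_one_ne_zero : (Fintype.card F : ℂ) - 1 ≠ 0 := by
  rw [← card_units_complex F, Nat.cast_ne_zero]
  exact Nat.card_pos.ne'



section ExistsIrr

variable {b}

theorem exists_coeffs_inl_ne_zero (α : Dual Fˣ) :
    ∃ π : IrrClass (PGL2 F), coeffs b π.character (.inl α) ≠ 0 := by
  classical
  refine exists_irrClass_ne_zero (fun φ => coeffs b φ (.inl α)) (fun φ ψ => coeffs_add b φ ψ _) ?_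
  have hc : (Nat.card (PGL2 F) : ℂ) ≠ 0 := by simp
  have h0 : (Fintype.card F : ℂ) ≠ 0 := by simp
  have h1 := card_sub_one_ne_zero (F := F)
  rw [coeffs_regular_inl, div_sub_div _ _ h1 h0]
  refine div_ne_zero ?_ (mul_ne_zero h1 h0)
  ring_nf
  exact hc

theorem exists_coeffs_inr_ne_zero (θ : Dual (NonsplitTorus F E)) :
    ∃ π : IrrClass (PGL2 F), coeffs b π.character (.inr θ) ≠ 0 := by
  classical
  refine exists_irrClass_ne_zero (fun φ => coeffs b φ (.inr θ)) (fun φ ψ => coeffs_add b φ ψ _) ?_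
  have hc : (Nat.card (PGL2 F) : ℂ) ≠ 0 := by simp
  have h0 : (Fintype.card F : ℂ) ≠ 0 := by simp
  have h1 := Nat.cast_add_one_ne_zero (R := ℂ) (Fintype.card F)
  rw [coeffs_regular_inr, div_sub_div _ _ h0 h1]
  refine div_ne_zero ?_ (mul_ne_zero h0 h1)
  ring_nf
  exact hc

/-- Used with θ the pullback of a quadratic α: the sum is 2 for the Steinberg shape and 0 for the
linear one. The difference, treated next, does the opposite. -/
theorem exists_coeffs_add_ne_zero (α : Dual Fˣ) (θ : Dual (NonsplitTorus F E)) :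
    ∃ π : IrrClass (PGL2 F),
      coeffs b π.character (.inl α) + coeffs b π.character (.inr θ) ≠ 0 := by
  classical
  refine exists_irrClass_ne_zero (fun φ => coeffs b φ (.inl α) + coeffs b φ (.inr θ))
    (fun φ ψ => by rw [coeffs_add, coeffs_add]; ring) ?_
  have hc : (Nat.card (PGL2 F) : ℂ) ≠ 0 := by simp
  have h0 := Nat.cast_add_one_ne_zero (R := ℂ) (Fintype.card F)
  have h1 := card_sub_one_ne_zero (F := F)
  rw [coeffs_regular_inl, coeffs_regular_inr, sub_add_sub_cancel, div_sub_div _ _ h1 h0]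
  refine div_ne_zero ?_ (mul_ne_zero h1 h0)
  ring_nf
  simp

theorem exists_coeffs_sub_ne_zero (α : Dual Fˣ) (θ : Dual (NonsplitTorus F E)) :
    ∃ π : IrrClass (PGL2 F),
      coeffs b π.character (.inl α) - coeffs b π.character (.inr θ) ≠ 0 := by
  classical
  refine exists_irrClass_ne_zero (fun φ => coeffs b φ (.inl α) - coeffs b φ (.inr θ))
    (fun φ ψ => by rw [coeffs_add, coeffs_add]; ring) ?_
  have hc : (Nat.card (PGL2 F) : ℂ) ≠ 0 := by simp
  have h0 := Nat.cast_add_one_ne_zero (R := ℂ) (Fintype.card F)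
  have h1 := card_sub_one_ne_zero (F := F)
  have h2 : (Fintype.card F : ℂ) ≠ 0 := by simp
  rw [coeffs_regular_inl, coeffs_regular_inr]
  have : (Nat.card (PGL2 F) : ℂ) / (Fintype.card F - 1) - Nat.card (PGL2 F) / Fintype.card F -
      (Nat.card (PGL2 F) / Fintype.card F - Nat.card (PGL2 F) / (Fintype.card F + 1)) =
      2 * Nat.card (PGL2 F) / ((Fintype.card F - 1) * Fintype.card F * (Fintype.card F + 1)) := by
    field_simp
    ring
  rw [this]
  exact div_ne_zero (mul_ne_zero two_ne_zero hc) (mul_ne_zero (mul_ne_zero h1 h2) h0)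

theorem eq_principal_of_coeffs_ne_zero {π : IrrClass (PGL2 F)} {α : Dual Fˣ} (hα : -α ≠ α)
    (h : coeffs b π.character (.inl α) ≠ 0) :
    coeffs b π.character = principalCoeffs F E α := by
  classical
  rcases π.coeffs_character_cases b with ⟨β, hβ, hc⟩ | ⟨θ, hθ, hc⟩ | ⟨β, hβ, hc⟩ | ⟨β, hβ, hc⟩ <;>
    rw [hc] at h ⊢
  · by_cases h1 : α = β
    · rw [h1]
    · by_cases h2 : α = -β
      · rw [h2, principalCoeffs, principalCoeffs, neg_neg, add_comm]
      · simp [principalCoeffs, h1, h2] at h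
  · simp [discreteCoeffs] at h
  · by_cases h1 : α = β
    · exact absurd hβ (h1 ▸ hα)
    · simp [steinbergCoeffs, h1] at h
  · by_cases h1 : α = β
    · exact absurd hβ (h1 ▸ hα)
    · simp [linearCoeffs, h1] at h

theorem eq_discrete_of_coeffs_ne_zero {π : IrrClass (PGL2 F)} {θ : Dual (NonsplitTorus F E)}
    (hθ : -θ ≠ θ) (h : coeffs b π.character (.inr θ) ≠ 0) :
    coeffs b π.character = discreteCoeffs θ := by
  classical
  rcases π.coeffs_character_cases b with ⟨β, hβ, hc⟩ | ⟨η, hη, hc⟩ | ⟨β, hβ, hc⟩ | ⟨β, hβ, hc⟩ <;>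
    rw [hc] at h ⊢
  · simp [principalCoeffs] at h
  · by_cases h1 : θ = η
    · rw [h1]
    · by_cases h2 : θ = -η
      · rw [h2, discreteCoeffs, discreteCoeffs, neg_neg, add_comm]
      · simp [discreteCoeffs, h1, h2] at h
  · by_cases h1 : θ = normPull b β hβ
    · exact absurd (neg_normPull b β hβ) (h1 ▸ hθ)
    · simp [steinbergCoeffs, h1] at h
  · by_cases h1 : θ = normPull b β hβ
    · exact absurd (neg_normPull b β hβ) (h1 ▸ hθ)
    · simp [linearCoeffs, h1] at h

theorem eq_steinberg_or_linear_of_coeffs_inl_ne_zero {π : IrrClass (PGL2 F)} {α : Dual Fˣ}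
    (hα : -α = α) (h : coeffs b π.character (.inl α) ≠ 0) :
    coeffs b π.character = steinbergCoeffs b α hα ∨
      coeffs b π.character = linearCoeffs b α hα := by
  classical
  rcases π.coeffs_character_cases b with ⟨β, hβ, hc⟩ | ⟨θ, hθ, hc⟩ | ⟨β, hβ, hc⟩ | ⟨β, hβ, hc⟩ <;>
    rw [hc] at h ⊢
  · by_cases h1 : α = β
    · exact absurd hα (h1 ▸ hβ)
    · by_cases h2 : α = -β
      · rw [h2, neg_neg] at hα
        exact absurd hα.symm hβ
      · simp [principalCoeffs, h1, h2] at h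
  · simp [discreteCoeffs] at h
  · by_cases h1 : α = β
    · subst h1; exact .inl rfl
    · simp [steinbergCoeffs, h1] at h
  · by_cases h1 : α = β
    · subst h1; exact .inr rfl
    · simp [linearCoeffs, h1] at h

theorem eq_steinberg_or_linear_of_coeffs_inr_ne_zero {π : IrrClass (PGL2 F)} {α : Dual Fˣ}
    (hα : -α = α) (h : coeffs b π.character (.inr (normPull b α hα)) ≠ 0) :
    coeffs b π.character = steinbergCoeffs b α hα ∨
      coeffs b π.character = linearCoeffs b α hα := by
  classical
  rcases π.coeffs_character_cases b with ⟨β, hβ, hc⟩ | ⟨θ, hθ, hc⟩ | ⟨β, hβ, hc⟩ | ⟨β, hβ, hc⟩ <;>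
    rw [hc] at h ⊢
  · simp [principalCoeffs] at h
  · have hn := neg_normPull b α hα
    by_cases h1 : normPull b α hα = θ
    · rw [h1] at hn
      exact absurd hn hθ
    · by_cases h2 : normPull b α hα = -θ
      · rw [h2, neg_neg] at hn
        exact absurd hn.symm hθ
      · simp [discreteCoeffs, h1, h2] at h
  · by_cases h1 : normPull b α hα = normPull b β hβ
    · obtain rfl := normPull_injective b hα hβ h1
      exact .inl rfl
    · simp [steinbergCoeffs, h1] at h
  · by_cases h1 : normPull b α hα = normPull b β hβ
    · obtain rfl := normPull_injective b hα hβ h1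
      exact .inr rfl
    · simp [linearCoeffs, h1] at h

theorem exists_principal {α : Dual Fˣ} (hα : -α ≠ α) :
    ∃ π : IrrClass (PGL2 F), coeffs b π.character = principalCoeffs F E α := by
  obtain ⟨π, h⟩ := exists_coeffs_inl_ne_zero (b := b) α
  exact ⟨π, eq_principal_of_coeffs_ne_zero hα h⟩

theorem exists_discrete {θ : Dual (NonsplitTorus F E)} (hθ : -θ ≠ θ) :
    ∃ π : IrrClass (PGL2 F), coeffs b π.character = discreteCoeffs θ := by
  obtain ⟨π, h⟩ := exists_coeffs_inr_ne_zero (b := b) θ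
  exact ⟨π, eq_discrete_of_coeffs_ne_zero hθ h⟩

theorem exists_steinberg {α : Dual Fˣ} (hα : -α = α) :
    ∃ π : IrrClass (PGL2 F), coeffs b π.character = steinbergCoeffs b α hα := by
  obtain ⟨π, h⟩ := exists_coeffs_add_ne_zero (b := b) α (normPull b α hα)
  refine ⟨π, ?_⟩
  have hor : coeffs b π.character = steinbergCoeffs b α hα ∨
      coeffs b π.character = linearCoeffs b α hα := by
    by_cases h1 : coeffs b π.character (.inl α) = 0
    · rw [h1, zero_add] at h
      exact eq_steinberg_or_linear_of_coeffs_inr_ne_zero hα h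
    · exact eq_steinberg_or_linear_of_coeffs_inl_ne_zero hα h1
  refine hor.resolve_right fun h1 => h ?_
  rw [h1]
  simp [linearCoeffs]

theorem exists_linear {α : Dual Fˣ} (hα : -α = α) :
    ∃ π : IrrClass (PGL2 F), coeffs b π.character = linearCoeffs b α hα := by
  obtain ⟨π, h⟩ := exists_coeffs_sub_ne_zero (b := b) α (normPull b α hα)
  refine ⟨π, ?_⟩
  have hor : coeffs b π.character = steinbergCoeffs b α hα ∨
      coeffs b π.character = linearCoeffs b α hα := by
    by_cases h1 : coeffs b π.character (.inl α) = 0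
    · rw [h1, zero_sub, neg_ne_zero] at h
      exact eq_steinberg_or_linear_of_coeffs_inr_ne_zero hα h
    · exact eq_steinberg_or_linear_of_coeffs_inl_ne_zero hα h1
  refine hor.resolve_left fun h1 => h ?_
  rw [h1]
  simp [steinbergCoeffs]

end ExistsIrr

open scoped Classical in
theorem sum_neg_eq_normPull (g : Dual (NonsplitTorus F E) → ℂ) (h : Dual Fˣ → ℂ)
    (hgh : ∀ α (hα : -α = α), g (normPull b α hα) = h α) :
    ∑ θ with -θ = θ, g θ = ∑ α with -α = α, h α := by
  symm
  refine Finset.sum_bij (fun α hα => normPull b α (by simpa using hα)) ?_ ?_ ?_ ?_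
  · intro α hα
    simpa using neg_normPull b α _
  · intro α hα β hβ h
    exact normPull_injective b _ _ h
  · intro θ hθ
    obtain ⟨α, hα, rfl⟩ := exists_normPull_eq b (by simpa using hθ : -θ = θ)
    exact ⟨α, by simpa using hα, rfl⟩
  · intro α hα
    exact (hgh α _).symm

open scoped Classical in
/-- Summation over the irreducible representations of `PGL(2, F)`. -/
theorem finsum_irrClass (Φ : IrrClass (PGL2 F) → ℂ) (p : Dual Fˣ → ℂ)
    (d : Dual (NonsplitTorus F E) → ℂ) (s l : Dual Fˣ → ℂ)
    (hp : ∀ π α, coeffs b π.character = principalCoeffs F E α → Φ π = p α)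
    (hd : ∀ π θ, coeffs b π.character = discreteCoeffs θ → Φ π = d θ)
    (hs : ∀ π α hα, coeffs b π.character = steinbergCoeffs b α hα → Φ π = s α)
    (hl : ∀ π α hα, coeffs b π.character = linearCoeffs b α hα → Φ π = l α) :
    ∑ᶠ π, Φ π = ∑ α with -α = α, (l α + s α) + (∑ α with -α ≠ α, p α) / 2 +
      (∑ θ with -θ ≠ θ, d θ) / 2 := by
  have hfin := IrrClass.finite_PGL2 b
  cases nonempty_fintype (IrrClass (PGL2 F))
  rw [finsum_eq_sum_of_fintype]
  -- The squared entries of each class sum to 2. After exchanging the sums, the column of a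
  -- character that is not self-inverse meets a single class, while the columns of a quadratic α and
  -- of α∘N both meet exactly its linear and Steinberg classes.
  have hcol (π : IrrClass (PGL2 F)) : Φ π = (∑ j, coeffs b π.character j ^ 2 * Φ π) / 2 := by
    obtain ⟨z, hz, hsum⟩ := π.exists_int_coeffs b
    rw [← Finset.sum_mul]
    simp only [hz]
    have : ∑ j, (z j : ℂ) ^ 2 = 2 := by exact_mod_cast hsum
    rw [this]
    ring
  have hprin (α : Dual Fˣ) (hα : -α ≠ α) :
      ∑ π : IrrClass (PGL2 F), coeffs b π.character (.inl α) ^ 2 * Φ π = p α := by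
    obtain ⟨π₀, h₀⟩ := exists_principal (b := b) hα
    rw [Finset.sum_eq_single π₀ _ (by simp), hp _ _ h₀, h₀]
    · simp [principalCoeffs, Ne.symm hα]
    · intro π _ hne
      by_cases h : coeffs b π.character (.inl α) = 0
      · simp [h]
      · exact absurd (IrrClass.coeffs_injective b
          ((eq_principal_of_coeffs_ne_zero hα h).trans h₀.symm)) hne
  have hdisc (θ : Dual (NonsplitTorus F E)) (hθ : -θ ≠ θ) :
      ∑ π : IrrClass (PGL2 F), coeffs b π.character (.inr θ) ^ 2 * Φ π = d θ := by
    obtain ⟨π₀, h₀⟩ := exists_discrete (b := b) hθ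
    rw [Finset.sum_eq_single π₀ _ (by simp), hd _ _ h₀, h₀]
    · simp [discreteCoeffs, Ne.symm hθ]
    · intro π _ hne
      by_cases h : coeffs b π.character (.inr θ) = 0
      · simp [h]
      · exact absurd (IrrClass.coeffs_injective b
          ((eq_discrete_of_coeffs_ne_zero hθ h).trans h₀.symm)) hne
  have hquad (α : Dual Fˣ) (hα : -α = α) (j) (hj : j = .inl α ∨ j = .inr (normPull b α hα)) :
      ∑ π : IrrClass (PGL2 F), coeffs b π.character j ^ 2 * Φ π = l α + s α := by
    obtain ⟨π₁, h₁⟩ := exists_linear (b := b) hα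
    obtain ⟨π₂, h₂⟩ := exists_steinberg (b := b) hα
    have hne : π₁ ≠ π₂ := by
      rintro rfl
      have := congrFun (h₁.symm.trans h₂) (.inr (normPull b α hα))
      simp [linearCoeffs, steinbergCoeffs] at this
      norm_num at this
    rw [Finset.sum_eq_add π₁ π₂ hne _ (by simp) (by simp), hl _ _ _ h₁, hs _ _ _ h₂, h₁, h₂]
    · rcases hj with rfl | rfl <;> simp [linearCoeffs, steinbergCoeffs]
    · intro π _ hπ
      by_cases h : coeffs b π.character j = 0
      · simp [h]
      · have : coeffs b π.character = steinbergCoeffs b α hα ∨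
            coeffs b π.character = linearCoeffs b α hα := by
          rcases hj with rfl | rfl
          · exact eq_steinberg_or_linear_of_coeffs_inl_ne_zero hα h
          · exact eq_steinberg_or_linear_of_coeffs_inr_ne_zero hα h
        rcases this with h' | h'
        · exact absurd (IrrClass.coeffs_injective b (h'.trans h₂.symm)) hπ.2
        · exact absurd (IrrClass.coeffs_injective b (h'.trans h₁.symm)) hπ.1
  have e1 := Finset.sum_filter_add_sum_filter_not Finset.univ (fun α : Dual Fˣ => -α = α)
    fun α => ∑ π : IrrClass (PGL2 F), coeffs b π.character (.inl α) ^ 2 * Φ π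
  have e2 := Finset.sum_filter_add_sum_filter_not Finset.univ
    (fun θ : Dual (NonsplitTorus F E) => -θ = θ)
    fun θ => ∑ π : IrrClass (PGL2 F), coeffs b π.character (.inr θ) ^ 2 * Φ π
  rw [Finset.sum_congr rfl fun α hα => hquad α (by simpa using hα) _ (.inl rfl),
    Finset.sum_congr rfl fun α hα => hprin α (by simpa using hα)] at e1
  rw [sum_neg_eq_normPull b _ (fun α => l α + s α) fun α hα => hquad α hα _ (.inr rfl),
    Finset.sum_congr rfl fun θ hθ => hdisc θ (by simpa using hθ)] at e2
  rw [Finset.sum_congr rfl fun π _ => hcol π, ← Finset.sum_div, Finset.sum_comm,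
    Fintype.sum_sum_type, ← e1, ← e2]
  ring

end Existence

/-! ### Frobenius–Schur indicators -/

section Indicator

variable {F E : Type*} [Field F] [Fintype F] [Field E] [Fintype E] [Algebra F E]
variable (b : Module.Basis (Fin 2) F E)

open scoped Classical in
theorem card_quadratic : (Even (Fintype.card F) →
      (Finset.univ.filter fun α : Dual Fˣ => -α = α) = {0}) ∧
    (Odd (Fintype.card F) →
      (Finset.univ.filter fun α : Dual Fˣ => -α = α) = {0, quadDual F}) := by
  constructor <;> intro hq <;> ext α <;>
    simp only [Finset.mem_filter, Finset.mem_univ, true_and, Finset.mem_insert,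
      Finset.mem_singleton]
  · refine ⟨Dual.eq_zero_of_odd_card (odd_card_units hq), ?_⟩
    rintro rfl
    exact neg_zero
  · refine ⟨eq_zero_or_eq_quadDual hq, ?_⟩
    rintro (rfl | rfl)
    · exact neg_zero
    · exact neg_quadDual F

open scoped Classical in
-- Integration over the tori keeps only self-inverse characters, of which both tori have equally
-- many. For q even there is one and u² = 1; for q odd there are two and u² is conjugate to u.
-- Either way the shifts and the unipotent correction combine to one `unipCoeff φ`.
theorem IsClassFun.avg_sq {φ : PGL2 F → ℂ} (hφ : IsClassFun φ) :
    avg (fun g => φ (g ^ 2)) = unipCoeff φ +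
      (∑ α with -α = α, coeffs b φ (.inl α)) / 2 - (∑ θ with -θ = θ, coeffs b φ (.inr θ)) / 2 := by
  have hsq : IsClassFun (fun g => φ (g ^ 2)) := fun g h => by
    simp only [conj_pow, hφ (g ^ 2) h]
  rw [hsq.avg_eq b]
  simp only [← map_pow]
  rw [avg_sq_eq_sum_fcoeff (fun x => φ (splitHom F x)),
    avg_sq_eq_sum_fcoeff (fun t => φ (nonsplitHom b t))]
  have h1 : ∑ θ : Dual (NonsplitTorus F E) with -θ = θ, (1 : ℂ) = ∑ α : Dual Fˣ with -α = α, 1 :=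
    sum_neg_eq_normPull b (fun _ => 1) (fun _ => 1) fun _ _ => rfl
  have hu2 : PGL2.unip F ^ 2 = unipHom F (Multiplicative.ofAdd 2) := by
    have h : PGL2.unip F = unipHom F (Multiplicative.ofAdd 1) := rfl
    rw [h, ← map_pow, ← ofAdd_nsmul]
    norm_num
  have hq0 : (Fintype.card F : ℂ) ≠ 0 := by simp
  have h2 : (∑ α : Dual Fˣ with -α = α, (1 : ℂ)) * unipCoeff φ -
      (φ (1 ^ 2) - φ (PGL2.unip F ^ 2)) / Fintype.card F = unipCoeff φ := by
    rcases Nat.even_or_odd (Fintype.card F) with hq | hq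
    · rw [card_quadratic.1 hq, hu2]
      have : (2 : F) = 0 := by
        have h2 : ringChar F = 2 := FiniteField.even_card_iff_char_two.mpr (Nat.even_iff.mp hq)
        exact_mod_cast (ringChar.spec F 2).mpr (h2 ▸ dvd_rfl)
      simp [this]
    · rw [card_quadratic.2 hq, hu2, hφ.apply_unipHom,
        Finset.sum_pair (quadDual_ne_zero F hq).symm, unipCoeff, one_pow]
      · ring
      · have h2 := ringChar_ne_two_of_odd_card hq
        exact fun h => Ring.two_ne_zero h2 (Multiplicative.ofAdd.injective h)
  have e1 : ∑ α : Dual Fˣ with -α = α, fcoeff (fun x => φ (splitHom F x)) α =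
      ∑ α with -α = α, coeffs b φ (.inl α) +
        (∑ α : Dual Fˣ with -α = α, (1 : ℂ)) * unipCoeff φ := by
    rw [Finset.sum_mul, ← Finset.sum_add_distrib]
    exact Finset.sum_congr rfl fun α _ => by rw [coeffs_inl]; ring
  have e2 : ∑ θ : Dual (NonsplitTorus F E) with -θ = θ, fcoeff (fun t => φ (nonsplitHom b t)) θ =
      (∑ α : Dual Fˣ with -α = α, (1 : ℂ)) * unipCoeff φ -
        ∑ θ with -θ = θ, coeffs b φ (.inr θ) := by
    rw [← h1, Finset.sum_mul, ← Finset.sum_sub_distrib]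
    exact Finset.sum_congr rfl fun θ _ => by rw [coeffs_inr]; ring
  rw [e1, e2]
  linear_combination h2

include b in
theorem IrrClass.frobeniusSchur_eq_one (π : IrrClass (PGL2 F)) : π.frobeniusSchur = 1 := by
  classical
  change avg (fun g => π.character (g ^ 2)) = 1
  rw [π.isClassFun_character.avg_sq b]
  -- Principal and discrete series give 1 + 0, Steinberg 1 + 1/2 - 1/2, linear 0 + 1/2 + 1/2.
  rcases π.coeffs_character_cases b with ⟨α, hα, h⟩ | ⟨θ, hθ, h⟩ | ⟨α, hα, h⟩ | ⟨α, hα, h⟩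
  · rw [unipCoeff_of_principal h, h]
    simp [principalCoeffs, Finset.sum_add_distrib, Pi.single_apply, hα, Ne.symm hα]
  · rw [unipCoeff_of_discrete h, h]
    simp [discreteCoeffs, Finset.sum_add_distrib, Pi.single_apply, hθ, Ne.symm hθ]
  · rw [unipCoeff_of_steinberg h, h]
    simp [steinbergCoeffs, Pi.single_apply, hα, neg_normPull]
  · rw [unipCoeff_of_linear h, h]
    simp [linearCoeffs, Pi.single_apply, hα, neg_normPull]
    norm_num

end Indicator

end

noncomputable section

/-! ### Zeta functions with insertions -/

section Zeta

variable {F E : Type*} [Field F] [Fintype F] [Field E] [Fintype E] [Algebra F E]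
variable (b : Module.Basis (Fin 2) F E)

open scoped Classical in
/-- The sum of the values of the quadratic characters of `Fˣ`. -/
def quadSum (x : Fˣ) : ℂ := ∑ α : Dual Fˣ with -α = α, α.ev x

theorem quadSum_of_even (hq : Even (Fintype.card F)) (x : Fˣ) : quadSum x = 1 := by
  rw [quadSum, card_quadratic.1 hq]
  simp

theorem quadSum_of_odd [DecidableEq F] (hq : Odd (Fintype.card F)) (x : Fˣ) :
    quadSum x = 1 + quadSign (x : F) := by
  classical
  rw [quadSum, card_quadratic.2 hq]
  have h := Finset.sum_pair (f := fun α : Dual Fˣ => α.ev x) (quadDual_ne_zero F hq).symm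
  simp only [Dual.ev_zero, quadDual_ev] at h
  convert h

theorem quadSum_inv (x : Fˣ) : quadSum x⁻¹ = quadSum x := by
  refine Finset.sum_congr rfl fun α hα => ?_
  rw [← Dual.ev_neg, show -α = α by simpa using hα]

open scoped Classical in
theorem sum_ev_filter_ne (x : Fˣ) : ∑ α : Dual Fˣ with -α ≠ α, α.ev x =
    ((Fintype.card F : ℂ) - 1) * deltaOne x - quadSum x := by
  rw [eq_sub_iff_add_eq, add_comm, quadSum, Finset.sum_filter_add_sum_filter_not, Dual.sum_ev,
    card_units_complex]
  simp [deltaOne, Set.indicator_apply]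

open scoped Classical in
include b in
theorem sum_ev_mk_filter_ne (y : Eˣ) :
    ∑ θ : Dual (NonsplitTorus F E) with -θ ≠ θ, θ.ev (QuotientGroup.mk y) =
      ((Fintype.card F : ℂ) + 1) * subfieldChar F (y : E) -
        quadSum (Units.map (Algebra.norm F) y) := by
  have h := sum_neg_eq_normPull b (fun θ => θ.ev (QuotientGroup.mk y))
    (fun α => α.ev (Units.map (Algebra.norm F) y)) fun α hα => normPull_ev_mk b α hα y
  rw [eq_sub_iff_add_eq, add_comm, quadSum, ← h, Finset.sum_filter_add_sum_filter_not, Dual.sum_ev,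
    card_nonsplitTorus (finrank_eq_two_of_basis b)]
  simp only [NonsplitTorus.mk_eq_one_iff, subfieldChar, Set.indicator_apply, Pi.one_apply, mul_ite,
    mul_one, mul_zero]

open scoped Classical in
-- The shapes have dimensions 1, q, q + 1 and q - 1. The factors 1/2 appear because α and -α label
-- the same principal series, and θ and -θ the same discrete series.
theorem zetaInsert_eq {r : ℕ} (γ : Fin r → PGL2 F) (P S L : Dual Fˣ → Fin r → ℂ)
    (D : Dual (NonsplitTorus F E) → Fin r → ℂ)
    (hP : ∀ φ α, IsClassFun φ → coeffs b φ = principalCoeffs F E α → ∀ i, φ (γ i) = P α i)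
    (hD : ∀ φ θ, IsClassFun φ → coeffs b φ = discreteCoeffs θ → ∀ i, φ (γ i) = D θ i)
    (hS : ∀ φ α hα, IsClassFun φ → coeffs b φ = steinbergCoeffs b α hα → ∀ i, φ (γ i) = S α i)
    (hL : ∀ φ α hα, IsClassFun φ → coeffs b φ = linearCoeffs b α hα → ∀ i, φ (γ i) = L α i)
    (s : ℂ) :
    zetaInsert γ s = ∑ α with -α = α, (∏ i, L α i + (∏ i, S α i) / (Fintype.card F : ℂ) ^ (s + r)) +
      (∑ α with -α ≠ α, ∏ i, P α i) / (2 * ((Fintype.card F : ℂ) + 1) ^ (s + r)) +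
      (∑ θ with -θ ≠ θ, ∏ i, D θ i) / (2 * ((Fintype.card F : ℂ) - 1) ^ (s + r)) := by
  rw [zetaInsert, finsum_irrClass b _
    (fun α => (∏ i, P α i) / ((Fintype.card F : ℂ) + 1) ^ (s + r))
    (fun θ => (∏ i, D θ i) / ((Fintype.card F : ℂ) - 1) ^ (s + r))
    (fun α => (∏ i, S α i) / (Fintype.card F : ℂ) ^ (s + r)) (fun α => ∏ i, L α i)]
  · rw [← Finset.sum_div, ← Finset.sum_div, div_div, div_div, mul_comm _ (2 : ℂ), mul_comm _ (2 : ℂ)]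
  · intro π α h
    simp only [← π.character_one, apply_one_of_principal h, hP _ α π.isClassFun_character h]
  · intro π α h
    simp only [← π.character_one, apply_one_of_discrete h, hD _ α π.isClassFun_character h]
  · intro π α hα h
    simp only [← π.character_one, apply_one_of_steinberg h, hS _ α hα π.isClassFun_character h]
  · intro π α hα h
    simp only [← π.character_one, apply_one_of_linear h, hL _ α hα π.isClassFun_character h,
      Complex.one_cpow, div_one]

include b in
theorem zetaRep_eq (s : ℂ) : zetaRep (PGL2 F) s =
    quadSum (1 : Fˣ) * (1 + 1 / (Fintype.card F : ℂ) ^ s) +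
      ((Fintype.card F : ℂ) - 1 - quadSum (1 : Fˣ)) / (2 * ((Fintype.card F : ℂ) + 1) ^ s) +
      ((Fintype.card F : ℂ) + 1 - quadSum (1 : Fˣ)) / (2 * ((Fintype.card F : ℂ) - 1) ^ s) := by
  classical
  -- The plain zeta function is the case of no insertions; empty products count characters of each
  -- kind.
  have h := zetaInsert_eq b ![] (fun _ => ![]) (fun _ => ![]) (fun _ => ![]) (fun _ => ![])
    (fun _ _ _ _ i => i.elim0) (fun _ _ _ _ i => i.elim0) (fun _ _ _ _ _ i => i.elim0)
    (fun _ _ _ _ _ i => i.elim0) s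
  have h1 := sum_ev_filter_ne (1 : Fˣ)
  have h2 := sum_ev_mk_filter_ne b 1
  have h3 : quadSum (1 : Fˣ) = ∑ α : Dual Fˣ with -α = α, 1 := by simp [quadSum]
  have h4 : zetaInsert (![] : Fin 0 → PGL2 F) s = zetaRep (PGL2 F) s := by
    simp [zetaInsert, zetaRep]
  simp only [Finset.univ_eq_empty, Finset.prod_empty, Nat.cast_zero, add_zero] at h
  simp only [map_one, QuotientGroup.mk_one, Units.val_one] at h1 h2
  rw [← h4, h, h1, h2, Finset.sum_const, h3]
  simp [deltaOne, subfieldChar]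
  ring

include b in
theorem zetaInsert_unip_eq (s : ℂ) : zetaInsert ![PGL2.unip F] s = quadSum (1 : Fˣ) +
      ((Fintype.card F : ℂ) - 1 - quadSum (1 : Fˣ)) / (2 * ((Fintype.card F : ℂ) + 1) ^ (s + 1)) -
      ((Fintype.card F : ℂ) + 1 - quadSum (1 : Fˣ)) /
        (2 * ((Fintype.card F : ℂ) - 1) ^ (s + 1)) := by
  classical
  have h := zetaInsert_eq b ![PGL2.unip F] (fun _ => ![1]) (fun _ => ![0]) (fun _ => ![1])
    (fun _ => ![-1])
    (fun φ α _ h i => by fin_cases i; simpa using apply_unip_of_principal h)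
    (fun φ α _ h i => by fin_cases i; simpa using apply_unip_of_discrete h)
    (fun φ α _ _ h i => by fin_cases i; simpa using apply_unip_of_steinberg h)
    (fun φ α _ _ h i => by fin_cases i; simpa using apply_unip_of_linear h) s
  have h1 := sum_ev_filter_ne (1 : Fˣ)
  have h2 := sum_ev_mk_filter_ne b 1
  have h3 : quadSum (1 : Fˣ) = ∑ α : Dual Fˣ with -α = α, 1 := by simp [quadSum]
  simp only [Finset.univ_unique, Finset.prod_singleton, Matrix.cons_val_fin_one, zero_div, add_zero,
    Finset.sum_neg_distrib, Nat.cast_one] at h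
  simp only [map_one, QuotientGroup.mk_one, Units.val_one] at h1 h2
  rw [h, h1, h2, h3]
  simp [deltaOne, subfieldChar]
  ring

include b in
theorem zetaInsert_diag_eq {r : ℕ} (hr : 1 ≤ r) (x : Fin r → Fˣ) (hx : ∀ i, x i ≠ 1) (s : ℂ) :
    zetaInsert (fun i => PGL2.diag (x i)) s =
      quadSum (∏ i, x i) * (1 + 1 / (Fintype.card F : ℂ) ^ (s + r)) +
        1 / (2 * ((Fintype.card F : ℂ) + 1) ^ (s + r)) * ∑ η : Fin r → ℤˣ,
          (((Fintype.card F : ℂ) - 1) * deltaOne (∏ i, x i ^ (η i : ℤ)) -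
            quadSum (∏ i, x i ^ (η i : ℤ))) := by
  classical
  have h := zetaInsert_eq b (fun i => PGL2.diag (x i)) (fun α i => α.ev (x i) + α.ev (x i)⁻¹)
    (fun α i => α.ev (x i)) (fun α i => α.ev (x i)) (fun _ _ => 0)
    (fun φ α _ h i => apply_splitHom_of_principal h (hx i))
    (fun φ α _ h i => apply_splitHom_of_discrete h (hx i))
    (fun φ α _ _ h i => apply_splitHom_of_steinberg h (hx i))
    (fun φ α _ _ h i => apply_splitHom_of_linear h (hx i)) s
  -- Expanding the product of sums gives one term for each choice of signs η.
  have hprod (α : Dual Fˣ) : ∏ i, (α.ev (x i) + α.ev (x i)⁻¹) =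
      ∑ η : Fin r → ℤˣ, α.ev (∏ i, x i ^ (η i : ℤ)) := by
    have (i : Fin r) : α.ev (x i) + α.ev (x i)⁻¹ = ∑ e : ℤˣ, α.ev (x i ^ (e : ℤ)) := by
      simp
    simp only [this, map_prod]
    rw [Finset.prod_univ_sum, Fintype.piFinset_univ]
  -- The discrete series vanish at diagonal elements; r ≥ 1 is needed here, as the empty product is
  -- 1.
  have h0 : ∏ _i : Fin r, (0 : ℂ) = 0 := Finset.prod_eq_zero (Finset.mem_univ ⟨0, hr⟩) rfl
  rw [h, Finset.sum_congr rfl fun α _ => hprod α, Finset.sum_comm,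
    Finset.sum_congr rfl fun η _ => sum_ev_filter_ne _]
  simp only [h0, Finset.sum_const_zero, zero_div, add_zero, ← map_prod, Finset.sum_add_distrib,
    ← Finset.sum_div]
  rw [quadSum]
  ring

/-- Conjugation acts on `Eˣ / Fˣ` by inversion. -/
theorem sum_algEquiv_ev (hE : Module.finrank F E = 2) (θ : Dual (NonsplitTorus F E)) (l : Eˣ) :
    ∑ σ : E ≃ₐ[F] E, θ.ev (QuotientGroup.mk (Units.map (σ : E →* E) l)) =
      θ.ev (QuotientGroup.mk l) + θ.ev (QuotientGroup.mk l)⁻¹ := by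
  classical
  have hcard : Fintype.card (E ≃ₐ[F] E) = 2 := by
    rw [← Nat.card_eq_fintype_card, IsGalois.card_aut_eq_finrank, hE]
  obtain ⟨σ, τ, hne, huniv⟩ := Finset.card_eq_two.mp (Finset.card_univ.trans hcard)
  have key (τ : E ≃ₐ[F] E) (hne : 1 ≠ τ) (huniv : (Finset.univ : Finset (E ≃ₐ[F] E)) = {1, τ}) :
      ∑ σ : E ≃ₐ[F] E, θ.ev (QuotientGroup.mk (Units.map (σ : E →* E) l)) =
      θ.ev (QuotientGroup.mk l) + θ.ev (QuotientGroup.mk l)⁻¹ := by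
    have hN := Algebra.norm_eq_prod_automorphisms F (l : E)
    rw [huniv, Finset.prod_pair hne] at hN
    rw [huniv, Finset.sum_pair hne]
    congr 2
    -- The product of l and its conjugate is the norm, which lies in F and is trivial in Eˣ/Fˣ.
    rw [eq_comm, inv_eq_iff_mul_eq_one, ← QuotientGroup.mk_mul, NonsplitTorus.mk_eq_one_iff]
    exact ⟨_, hN⟩
  have h1 : (1 : E ≃ₐ[F] E) ∈ ({σ, τ} : Finset (E ≃ₐ[F] E)) := huniv ▸ Finset.mem_univ 1
  rw [Finset.mem_insert, Finset.mem_singleton] at h1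
  rcases h1 with rfl | rfl
  · exact key τ hne huniv
  · exact key σ hne.symm (by rw [huniv, Finset.pair_comm])

theorem zetaInsert_ell_eq (hE : Module.finrank F E = 2) [FiniteDimensional F E] {r : ℕ}
    (hr : 1 ≤ r) (l : Fin r → Eˣ)
    (hl : ∀ i, (l i : E) ∉ Set.range (algebraMap F E)) (s : ℂ) :
    zetaInsert (fun i => PGL2.ell F (l i)) s =
      quadSum (∏ i, Units.map (Algebra.norm F) (l i)) *
          (1 + (-1) ^ r / (Fintype.card F : ℂ) ^ (s + r)) +
        (-1) ^ r / (2 * ((Fintype.card F : ℂ) - 1) ^ (s + r)) * ∑ η : Fin r → (E ≃ₐ[F] E),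
          (((Fintype.card F : ℂ) + 1) * subfieldChar F (∏ i, η i (l i : E)) -
            quadSum (Units.map (Algebra.norm F) (∏ i, Units.map (η i : E →* E) (l i)))) := by
  classical
  let b : Module.Basis (Fin 2) F E := Module.finBasisOfFinrankEq F E hE
  have hl1 (i) : (QuotientGroup.mk (l i) : NonsplitTorus F E) ≠ 1 :=
    fun h => hl i ((NonsplitTorus.mk_eq_one_iff _).mp h)
  have h := zetaInsert_eq b (fun i => PGL2.ell F (l i)) (fun _ _ => 0)
    (fun α i => -α.ev (Units.map (Algebra.norm F) (l i)))
    (fun α i => α.ev (Units.map (Algebra.norm F) (l i)))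
    (fun θ i => -(θ.ev (QuotientGroup.mk (l i)) + θ.ev (QuotientGroup.mk (l i))⁻¹))
    (fun φ α hφ h i => by
      rw [hφ.apply_ell b (hl i), apply_nonsplitHom_of_principal h (hl1 i)])
    (fun φ α hφ h i => by
      rw [hφ.apply_ell b (hl i), apply_nonsplitHom_of_discrete h (hl1 i)])
    (fun φ α hα hφ h i => by
      rw [hφ.apply_ell b (hl i), apply_nonsplitHom_of_steinberg h (hl1 i), normPull_ev_mk])
    (fun φ α hα hφ h i => by
      rw [hφ.apply_ell b (hl i), apply_nonsplitHom_of_linear h (hl1 i), normPull_ev_mk]) s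
  have hprod (θ : Dual (NonsplitTorus F E)) :
      ∏ i, -(θ.ev (QuotientGroup.mk (l i)) + θ.ev (QuotientGroup.mk (l i))⁻¹) =
      (-1) ^ r * ∑ η : Fin r → (E ≃ₐ[F] E),
        θ.ev (QuotientGroup.mk (∏ i, Units.map (η i : E →* E) (l i))) := by
    simp only [← sum_algEquiv_ev hE]
    rw [Finset.prod_neg, Finset.card_univ, Fintype.card_fin, Finset.prod_univ_sum,
      Fintype.piFinset_univ]
    congr 1
    refine Finset.sum_congr rfl fun η _ => ?_
    rw [← map_prod]
    congr 1
    exact (QuotientGroup.mk_prod _ _).symm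
  have hval (η : Fin r → (E ≃ₐ[F] E)) :
      ((∏ i, Units.map (η i : E →* E) (l i) : Eˣ) : E) = ∏ i, η i (l i : E) := by
    rw [Units.coe_prod]
    rfl
  have h0 : ∏ _i : Fin r, (0 : ℂ) = 0 := Finset.prod_eq_zero (Finset.mem_univ ⟨0, hr⟩) rfl
  rw [h, Finset.sum_congr rfl fun θ _ => hprod θ, ← Finset.mul_sum, Finset.sum_comm,
    Finset.sum_congr rfl fun η _ => sum_ev_mk_filter_ne b _]
  simp only [h0, Finset.sum_const_zero, zero_div, add_zero, Finset.sum_add_distrib,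
    ← Finset.sum_div, Finset.prod_neg, Finset.card_univ, Fintype.card_fin, hval, ← Finset.mul_sum]
  simp only [← map_prod]
  rw [quadSum]
  ring

/-- Principal series vanish at elliptic elements and discrete series at split ones, so only
dimensions 1 and q contribute. -/
theorem zetaInsert_append_eq (hE : Module.finrank F E = 2) [FiniteDimensional F E] {m n : ℕ}
    (hm : 1 ≤ m) (hn : 1 ≤ n) (x : Fin m → Fˣ) (l : Fin n → Eˣ) (hx : ∀ i, x i ≠ 1)
    (hl : ∀ i, (l i : E) ∉ Set.range (algebraMap F E)) (s : ℂ) :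
    zetaInsert (Fin.append (fun i => PGL2.diag (x i)) (fun i => PGL2.ell F (l i))) s =
      (1 + (-1) ^ n / (Fintype.card F : ℂ) ^ (s + (m + n))) *
        quadSum ((∏ i, x i) * ∏ i, Units.map (Algebra.norm F) (l i)) := by
  classical
  let b : Module.Basis (Fin 2) F E := Module.finBasisOfFinrankEq F E hE
  have hl1 (i) : (QuotientGroup.mk (l i) : NonsplitTorus F E) ≠ 1 :=
    fun h => hl i ((NonsplitTorus.mk_eq_one_iff _).mp h)
  have h := zetaInsert_eq b
    (Fin.append (fun i => PGL2.diag (x i)) (fun i => PGL2.ell F (l i)))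
    (fun α => Fin.append (fun i => α.ev (x i) + α.ev (x i)⁻¹) (fun _ => 0))
    (fun α => Fin.append (fun i => α.ev (x i)) (fun i => -α.ev (Units.map (Algebra.norm F) (l i))))
    (fun α => Fin.append (fun i => α.ev (x i)) (fun i => α.ev (Units.map (Algebra.norm F) (l i))))
    (fun θ => Fin.append (fun _ => 0)
      (fun i => -(θ.ev (QuotientGroup.mk (l i)) + θ.ev (QuotientGroup.mk (l i))⁻¹)))
    (fun φ α hφ h i => by
      refine Fin.addCases (fun i => ?_) (fun i => ?_) i
      · rw [Fin.append_left, Fin.append_left]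
        exact apply_splitHom_of_principal h (hx i)
      · rw [Fin.append_right, Fin.append_right, hφ.apply_ell b (hl i),
          apply_nonsplitHom_of_principal h (hl1 i)])
    (fun φ α hφ h i => by
      refine Fin.addCases (fun i => ?_) (fun i => ?_) i
      · rw [Fin.append_left, Fin.append_left]
        exact apply_splitHom_of_discrete h (hx i)
      · rw [Fin.append_right, Fin.append_right, hφ.apply_ell b (hl i),
          apply_nonsplitHom_of_discrete h (hl1 i)])
    (fun φ α hα hφ h i => by
      refine Fin.addCases (fun i => ?_) (fun i => ?_) i
      · rw [Fin.append_left, Fin.append_left]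
        exact apply_splitHom_of_steinberg h (hx i)
      · rw [Fin.append_right, Fin.append_right, hφ.apply_ell b (hl i),
          apply_nonsplitHom_of_steinberg h (hl1 i), normPull_ev_mk])
    (fun φ α hα hφ h i => by
      refine Fin.addCases (fun i => ?_) (fun i => ?_) i
      · rw [Fin.append_left, Fin.append_left]
        exact apply_splitHom_of_linear h (hx i)
      · rw [Fin.append_right, Fin.append_right, hφ.apply_ell b (hl i),
          apply_nonsplitHom_of_linear h (hl1 i), normPull_ev_mk]) s
  have h0 {k : ℕ} (hk : 1 ≤ k) : ∏ _i : Fin k, (0 : ℂ) = 0 :=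
    Finset.prod_eq_zero (Finset.mem_univ ⟨0, hk⟩) rfl
  rw [h]
  simp only [Fin.prod_univ_add, Fin.append_left, Fin.append_right, h0 hm, h0 hn, mul_zero, zero_mul,
    Finset.sum_const_zero, zero_div, add_zero, Finset.prod_neg, Finset.card_univ, Fintype.card_fin,
    Nat.cast_add]
  simp only [← map_prod]
  rw [quadSum, Finset.mul_sum]
  refine Finset.sum_congr rfl fun α _ => ?_
  rw [map_mul]
  ring

include b in
theorem zetaInsert_single_diag_eq {x : Fˣ} (hx : x ≠ 1) (s : ℂ) :
    zetaInsert ![PGL2.diag x] s = quadSum x *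
      (1 + 1 / (Fintype.card F : ℂ) ^ (s + 1) - 1 / ((Fintype.card F : ℂ) + 1) ^ (s + 1)) := by
  have h := zetaInsert_diag_eq b le_rfl (fun _ : Fin 1 => x) (fun _ => hx) s
  have h1 : (![PGL2.diag x] : Fin 1 → PGL2 F) = fun _ => PGL2.diag x := by
    ext i; fin_cases i; rfl
  -- Neither x nor its inverse is 1, so δ vanishes. The two equal terms cancel the factor 1/2.
  have hterm (e : ℤˣ) : ((Fintype.card F : ℂ) - 1) * deltaOne (x ^ (e : ℤ)) -
      quadSum (x ^ (e : ℤ)) = -quadSum x := by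
    rcases Int.units_eq_one_or e with rfl | rfl
    · simp [deltaOne, hx]
    · simp [deltaOne, hx, quadSum_inv]
  simp only [Finset.univ_unique, Finset.prod_singleton, hterm, Nat.cast_one, Finset.sum_const,
    Finset.card_univ, nsmul_eq_mul] at h
  have hc : Fintype.card (Fin 1 → ℤˣ) = 2 := by simp
  rw [h1, h, hc]
  push_cast
  ring

theorem zetaInsert_single_ell_eq (hE : Module.finrank F E = 2) [FiniteDimensional F E] {l : Eˣ}
    (hl : (l : E) ∉ Set.range (algebraMap F E)) (s : ℂ) :
    zetaInsert ![PGL2.ell F l] s = quadSum (Units.map (Algebra.norm F) l) *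
      (1 - 1 / (Fintype.card F : ℂ) ^ (s + 1) + 1 / ((Fintype.card F : ℂ) - 1) ^ (s + 1)) := by
  have h := zetaInsert_ell_eq hE le_rfl (fun _ : Fin 1 => l) (fun _ => hl) s
  have h1 : (![PGL2.ell F l] : Fin 1 → PGL2 F) = fun _ => PGL2.ell F l := by
    ext i; fin_cases i; rfl
  -- A conjugate of l stays outside F and has the same norm, so both automorphisms contribute
  -- equally.
  have hterm (σ : E ≃ₐ[F] E) : ((Fintype.card F : ℂ) + 1) * subfieldChar F (σ (l : E)) -
      quadSum (Units.map (Algebra.norm F) (Units.map (σ : E →* E) l)) =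
        -quadSum (Units.map (Algebra.norm F) l) := by
    have h2 : σ (l : E) ∉ Set.range (algebraMap F E) := by
      rintro ⟨z, hz⟩
      exact hl ⟨z, σ.injective (by rw [← hz, AlgEquiv.commutes])⟩
    have h3 : Units.map (Algebra.norm F) (Units.map (σ : E →* E) l) =
        Units.map (Algebra.norm F) l := Units.ext (Algebra.norm_eq_of_algEquiv σ (l : E))
    rw [h3, subfieldChar, Set.indicator_of_notMem h2, mul_zero, zero_sub]
  have hc : Fintype.card (Fin 1 → (E ≃ₐ[F] E)) = 2 := by
    rw [Fintype.card_fun, Fintype.card_fin, pow_one, ← Nat.card_eq_fintype_card,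
      IsGalois.card_aut_eq_finrank, hE]
  simp only [Finset.univ_unique, Finset.prod_singleton, hterm, Nat.cast_one, Finset.sum_const,
    Finset.card_univ, nsmul_eq_mul] at h
  rw [h1, h, hc]
  push_cast
  ring

end Zeta

end

/-! ### Specialisation to odd and even q -/

theorem mainTheorem9 (F E : Type*) [Field F] [Fintype F] [DecidableEq F]
    [Field E] [Fintype E] [DecidableEq E] [Algebra F E] (hE : Module.finrank F E = 2)
    (q : ℕ) (hq : Fintype.card F = q) :
    Finite (IrrClass (PGL2 F)) ∧
    (∀ s : ℂ, zetaIndicator (PGL2 F) (-1) s = 0 ∧ zetaIndicator (PGL2 F) 0 s = 0) ∧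
    -- odd characteristic
    (Odd q →
      (∀ s : ℂ, zetaRep (PGL2 F) s =
        2 + ((q : ℂ) - 3) / (2 * ((q : ℂ) + 1) ^ s) + 2 / (q : ℂ) ^ s
          + ((q : ℂ) - 1) / (2 * ((q : ℂ) - 1) ^ s)) ∧
      -- one unipotent insertion
      (∀ s : ℂ, zetaInsert ![PGL2.unip F] s =
        2 + ((q : ℂ) - 3) / (2 * ((q : ℂ) + 1) ^ (s + 1))
          - ((q : ℂ) - 1) / (2 * ((q : ℂ) - 1) ^ (s + 1))) ∧
      -- one diagonal insertion
      (∀ (x : Fˣ), x ≠ 1 → ∀ s : ℂ, zetaInsert ![PGL2.diag x] s =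
        (1 + 1 / (q : ℂ) ^ (s + 1) - 1 / ((q : ℂ) + 1) ^ (s + 1)) * (1 + quadSign (x : F))) ∧
      -- one elliptic insertion
      (∀ (l : Eˣ), (l : E) ∉ Set.range (algebraMap F E) → ∀ s : ℂ,
        zetaInsert ![PGL2.ell F l] s =
          (1 + 1 / ((q : ℂ) - 1) ^ (s + 1) - 1 / (q : ℂ) ^ (s + 1))
            + quadSign (Algebra.norm F (l : E)) * (1 - 1 / (q : ℂ) ^ (s + 1))
            + 1 / ((q : ℂ) - 1) ^ (s + 1) * quadSign (l : E)) ∧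
      -- all insertions diagonal
      (∀ (r : ℕ), 1 ≤ r → ∀ x : Fin r → Fˣ, (∀ i, x i ≠ 1) → ∀ s : ℂ,
        zetaInsert (fun i => PGL2.diag (x i)) s =
          (1 + quadSign (∏ i, (x i : F))) * (1 + 1 / (q : ℂ) ^ (s + r))
            + 1 / (2 * ((q : ℂ) + 1) ^ (s + r)) *
              ∑ η : Fin r → ℤˣ, (((q : ℂ) - 1) * deltaOne (∏ i, x i ^ (η i : ℤ)) - 1
                - quadSign ((∏ i, x i ^ (η i : ℤ) : Fˣ) : F))) ∧
      -- all insertions elliptic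
      (∀ (r : ℕ), 1 ≤ r → ∀ l : Fin r → Eˣ, (∀ i, (l i : E) ∉ Set.range (algebraMap F E)) →
        ∀ s : ℂ, zetaInsert (fun i => PGL2.ell F (l i)) s =
          (1 + quadSign (∏ i, Algebra.norm F (l i : E))) * (1 + (-1) ^ r / (q : ℂ) ^ (s + r))
            + (-1) ^ r / (2 * ((q : ℂ) - 1) ^ (s + r)) *
              ∑ η : Fin r → (E ≃ₐ[F] E), (((q : ℂ) + 1) * subfieldChar F (∏ i, η i (l i : E)) - 1
                - quadSign (∏ i, η i (l i : E)))) ∧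
      -- `m` diagonal and `n` elliptic insertions
      (∀ (m n : ℕ), 1 ≤ m → 1 ≤ n → ∀ (x : Fin m → Fˣ) (l : Fin n → Eˣ), (∀ i, x i ≠ 1) →
        (∀ i, (l i : E) ∉ Set.range (algebraMap F E)) → ∀ s : ℂ,
        zetaInsert (Fin.append (fun i => PGL2.diag (x i)) (fun i => PGL2.ell F (l i))) s =
          (1 + (-1) ^ n / (q : ℂ) ^ (s + (m + n))) *
            (1 + quadSign ((∏ i, (x i : F)) * ∏ i, Algebra.norm F (l i : E))))) ∧
    -- characteristic two
    (Even q →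
      (∀ s : ℂ, zetaRep (PGL2 F) s =
        1 + ((q : ℂ) - 2) / (2 * ((q : ℂ) + 1) ^ s) + 1 / (q : ℂ) ^ s
          + (q : ℂ) / (2 * ((q : ℂ) - 1) ^ s)) ∧
      -- one unipotent insertion
      (∀ s : ℂ, zetaInsert ![PGL2.unip F] s =
        1 + ((q : ℂ) - 2) / (2 * ((q : ℂ) + 1) ^ (s + 1))
          - (q : ℂ) / (2 * ((q : ℂ) - 1) ^ (s + 1))) ∧
      -- one diagonal insertion
      (∀ (x : Fˣ), x ≠ 1 → ∀ s : ℂ, zetaInsert ![PGL2.diag x] s =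
        1 - 1 / ((q : ℂ) + 1) ^ (s + 1) + 1 / (q : ℂ) ^ (s + 1)) ∧
      -- one elliptic insertion
      (∀ (l : Eˣ), (l : E) ∉ Set.range (algebraMap F E) → ∀ s : ℂ,
        zetaInsert ![PGL2.ell F l] s =
          1 - 1 / (q : ℂ) ^ (s + 1) + 1 / ((q : ℂ) - 1) ^ (s + 1)) ∧
      -- all insertions diagonal
      (∀ (r : ℕ), 1 ≤ r → ∀ x : Fin r → Fˣ, (∀ i, x i ≠ 1) → ∀ s : ℂ,
        zetaInsert (fun i => PGL2.diag (x i)) s =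
          (1 + 1 / (q : ℂ) ^ (s + r))
            + 1 / (2 * ((q : ℂ) + 1) ^ (s + r)) *
              ∑ η : Fin r → ℤˣ, (((q : ℂ) - 1) * deltaOne (∏ i, x i ^ (η i : ℤ)) - 1)) ∧
      -- all insertions elliptic
      (∀ (r : ℕ), 1 ≤ r → ∀ l : Fin r → Eˣ, (∀ i, (l i : E) ∉ Set.range (algebraMap F E)) →
        ∀ s : ℂ, zetaInsert (fun i => PGL2.ell F (l i)) s =
          (1 + (-1) ^ r / (q : ℂ) ^ (s + r))
            + (-1) ^ r / (2 * ((q : ℂ) - 1) ^ (s + r)) *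
              ∑ η : Fin r → (E ≃ₐ[F] E),
                (((q : ℂ) + 1) * subfieldChar F (∏ i, η i (l i : E)) - 1)) ∧
      -- `m` diagonal and `n` elliptic insertions
      (∀ (m n : ℕ), 1 ≤ m → 1 ≤ n → ∀ (x : Fin m → Fˣ) (l : Fin n → Eˣ), (∀ i, x i ≠ 1) →
        (∀ i, (l i : E) ∉ Set.range (algebraMap F E)) → ∀ s : ℂ,
        zetaInsert (Fin.append (fun i => PGL2.diag (x i)) (fun i => PGL2.ell F (l i))) s =
          1 + (-1) ^ n / (q : ℂ) ^ (s + (m + n)))) := by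
  subst hq
  have : FiniteDimensional F E := .of_finrank_pos (by omega)
  let b : Module.Basis (Fin 2) F E := Module.finBasisOfFinrankEq F E hE
  have hnorm (r : ℕ) (l : Fin r → Eˣ) : ((∏ i, Units.map (Algebra.norm F) (l i) : Fˣ) : F) =
      ∏ i, Algebra.norm F (l i : E) := by
    rw [Units.coe_prod]
    rfl
  have hcoe (r : ℕ) (x : Fin r → Fˣ) : ((∏ i, x i : Fˣ) : F) = ∏ i, (x i : F) :=
    Units.coe_prod _ _
  refine ⟨IrrClass.finite_PGL2 b, fun s => ⟨?_, ?_⟩, fun hq => ⟨?_, ?_, ?_, ?_, ?_, ?_, ?_⟩,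
    fun hq => ⟨?_, ?_, ?_, ?_, ?_, ?_, ?_⟩⟩
  · have : IsEmpty {π : IrrClass (PGL2 F) // π.frobeniusSchur = ((-1 : ℤ) : ℂ)} :=
      ⟨fun π => by
        have h := π.2
        rw [IrrClass.frobeniusSchur_eq_one b] at h
        norm_num at h⟩
    exact finsum_of_isEmpty _
  · have : IsEmpty {π : IrrClass (PGL2 F) // π.frobeniusSchur = ((0 : ℤ) : ℂ)} :=
      ⟨fun π => by
        have h := π.2
        rw [IrrClass.frobeniusSchur_eq_one b] at h
        norm_num at h⟩
    exact finsum_of_isEmpty _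
  · intro s
    rw [zetaRep_eq b, quadSum_of_odd hq]
    simp [quadSign, -quadraticChar_apply]
    ring
  · intro s
    rw [zetaInsert_unip_eq b, quadSum_of_odd hq]
    simp [quadSign, -quadraticChar_apply]
    ring
  · intro x hx s
    rw [zetaInsert_single_diag_eq b hx, quadSum_of_odd hq]
    ring
  · intro l hl s
    -- Since ε_E = ε∘N, the last two terms of the stated formula combine into ε(N l) times the
    -- bracket multiplying 1.
    rw [zetaInsert_single_ell_eq hE hl, quadSum_of_odd hq, ← quadSign_norm hE hq,
      Units.coe_map]
    ring
  · intro r hr x hx s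
    rw [zetaInsert_diag_eq b hr x hx]
    simp only [quadSum_of_odd hq, hcoe, sub_sub]
  · intro r hr l hl s
    rw [zetaInsert_ell_eq hE hr l hl]
    have hval (η : Fin r → (E ≃ₐ[F] E)) :
        quadSum (Units.map (Algebra.norm F) (∏ i, Units.map (η i : E →* E) (l i))) =
          1 + quadSign (∏ i, η i (l i : E)) := by
      have h1 : ((∏ i, Units.map (η i : E →* E) (l i) : Eˣ) : E) = ∏ i, η i (l i : E) := by
        rw [Units.coe_prod]
        rfl
      rw [quadSum_of_odd hq, ← h1, ← quadSign_norm hE hq]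
      rfl
    simp only [hval, quadSum_of_odd hq, hnorm, sub_sub]
  · intro m n hm hn x l hx hl s
    rw [zetaInsert_append_eq hE hm hn x l hx hl, quadSum_of_odd hq, Units.val_mul, hcoe, hnorm]
  · intro s
    rw [zetaRep_eq b, quadSum_of_even hq]
    ring
  · intro s
    rw [zetaInsert_unip_eq b, quadSum_of_even hq]
    ring
  · intro x hx s
    rw [zetaInsert_single_diag_eq b hx, quadSum_of_even hq]
    ring
  · intro l hl s
    rw [zetaInsert_single_ell_eq hE hl, quadSum_of_even hq, one_mul]
  · intro r hr x hx s
    rw [zetaInsert_diag_eq b hr x hx]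
    simp only [quadSum_of_even hq, one_mul]
  · intro r hr l hl s
    rw [zetaInsert_ell_eq hE hr l hl]
    simp only [quadSum_of_even hq, one_mul]
  · intro m n hm hn x l hx hl s
    rw [zetaInsert_append_eq hE hm hn x l hx hl, quadSum_of_even hq, mul_one]
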